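/- Let $\chi$ be an elliptic curve over a finite field $\mathbb{F}_q$, with group of rational points $E(\mathbb{F}_q)$, and suppose that $N=|E(\mathbb{F}_q)|$ is even. For pairwise distinct rational points $P_1,\dots,P_n$ of $\chi$, $D=P_1+\cdots+P_n$, and a divisor $G$ of the function field $\mathbb{F}_q(\chi)$ whose support contains none of the $P_i$, let $\mathscr{L}(G)=\{f\in\mathbb{F}_q(\chi)^{*} : (f)+G\ge 0\}\cup\{0\}$ and let $C_{\mathscr{L}}(D,G)=\{(f(P_1),\dots,f(P_n)) : f\in\mathscr{L}(G)\}\subseteq\mathbb{F}_q^n$ be the associated algebraic geometry code. An $[n,k,d]$ code is a linear code of length $n$, dimension $k$ and minimum distance $d$; it is MDS if $d=n-k+1$. Then $E(\mathbb{F}_q)$ has a subgroup of index $2$, and for every subgroup $H$ of $E(\mathbb{F}_q)$ of index $2$ the set $E(\mathbb{F}_q)\setminus H$ is nonempty and the following hold. (1) Let $k$ be odd with $1\le k\le N/2$, let $Q\in E(\mathbb{F}_q)\setminus H$, and let $D$ be the sum of all points of $H$. Then $C_{\mathscr{L}}(D,kQ)$ is an MDS code with parameters $[N/2,\,k,\,N/2-k+1]$.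 (2) Let $k$ be even with $2\le k\le N/2-1$, let $P\in H$ and $Q\in E(\mathbb{F}_q)\setminus H$, and let $D$ be the sum of all points of $H\setminus\{P\}$. Then $C_{\mathscr{L}}(D,(k-1)P+Q)$ is an MDS code with parameters $[N/2-1,\,k,\,N/2-k]$. -/

import Mathlib

open WithZero Polynomial
open scoped nonZeroDivisors Polynomial.Bivariate

/-! ## Places, divisors and Riemann-Roch spaces of a function field `K / F` -/

/-- A place of `K / F`, given by its normalized discrete valuation, i.e. by the surjective
valuation `v : K → ℤᵐ⁰` that is trivial on the constants `F`.
The valuation is written multiplicatively: `v f = exp (- ord_v f)`. In a function field of one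
variable every place is discrete, so these are all the places, non-rational ones included. -/
@[ext]
structure Place (F K : Type*) [Field F] [Field K] [Algebra F K] where
  /-- the multiplicatively written valuation -/
  val : Valuation K ℤᵐ⁰
  surjective : Function.Surjective val
  trivial_on_constants : ∀ c : F, c ≠ 0 → val (algebraMap F K c) = 1

namespace Place

variable {F K : Type*} [Field F] [Field K] [Algebra F K]

/-- The order of `f` at the place `v` (with the junk value `0` for `f = 0`). -/
noncomputable def ord (v : Place F K) (f : K) : ℤ := -log (v.val f)

theorem val_constant_le_one (v : Place F K) (c : F) : v.val (algebraMap F K c) ≤ 1 := by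
  by_cases hc : c = 0
  · simp [hc]
  · exact (v.trivial_on_constants c hc).le

/-- `v.HasValue f c`: the function `f` is regular at the place `v` and its class in the
residue field of `v` is (the image of) the constant `c`, i.e. `f(v) = c`. -/
def HasValue (v : Place F K) (f : K) (c : F) : Prop :=
  v.val (f - algebraMap F K c) < 1

end Place

/-- A divisor of `K / F`: a formal `ℤ`-linear combination of places. -/
abbrev PlaceDivisor (F K : Type*) [Field F] [Field K] [Algebra F K] : Type _ :=
  Place F K →₀ ℤ

theorem ord_add_nonneg_iff {F K : Type*} [Field F] [Field K] [Algebra F K]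
    (G : PlaceDivisor F K) (f : K) :
    (f ≠ 0 → ∀ v : Place F K, 0 ≤ v.ord f + G v) ↔ ∀ v : Place F K, v.val f ≤ exp (G v) := by
  by_cases hf : f = 0
  · simp [hf]
  · simp only [ne_eq, hf, not_false_eq_true, forall_const]
    refine forall_congr' fun v => ?_
    rw [← log_le_iff_le_exp ((Valuation.ne_zero_iff _).2 hf), Place.ord]
    omega

/-- The Riemann-Roch space `L(G) = {f | (f) + G ≥ 0} ∪ {0}`. -/
noncomputable def riemannRochSpace {F K : Type*} [Field F] [Field K] [Algebra F K]
    (G : PlaceDivisor F K) : Submodule F K where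
  carrier := {f | f ≠ 0 → ∀ v : Place F K, 0 ≤ v.ord f + G v}
  zero_mem' := fun h => absurd rfl h
  add_mem' := by
    intro f g hf hg
    simp only [Set.mem_ofPred_eq, ord_add_nonneg_iff] at hf hg ⊢
    exact fun v => v.val.map_add_le (hf v) (hg v)
  smul_mem' := by
    intro c f hf
    simp only [Set.mem_ofPred_eq, ord_add_nonneg_iff] at hf ⊢
    intro v
    rw [Algebra.smul_def, map_mul]
    exact (mul_le_of_le_one_left' (v.val_constant_le_one c)).trans (hf v)

/-! ## Linear codes -/

section Codes

variable {F : Type*} [Field F] {ι : Type*} [Fintype ι]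

open scoped Classical in
/-- `d` is the minimum distance of the linear code `C`: the least Hamming weight of a nonzero
codeword. -/
def IsMinDistance (C : Submodule F (ι → F)) (d : ℕ) : Prop :=
  IsLeast {w : ℕ | ∃ c ∈ C, c ≠ 0 ∧ hammingNorm c = w} d

/-- `C` is an `[n, k, d]` code: length `n`, dimension `k`, minimum distance `d`. -/
def IsLinearCode (C : Submodule F (ι → F)) (n k d : ℕ) : Prop :=
  Fintype.card ι = n ∧ Module.finrank F C = k ∧ IsMinDistance C d

/-- `C` is maximum distance separable: its parameters attain the Singleton bound
`d = n - k + 1`. -/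
def IsMDS (C : Submodule F (ι → F)) : Prop :=
  ∃ n k d : ℕ, IsLinearCode C n k d ∧ d + k = n + 1

/-- The algebraic geometry code `C_L(D, G)` for `D = ∑ i, P i`: the vectors `(f(P i))_i` with `f` in
the Riemann-Roch space `L(G)`. It is meant for pairwise distinct rational places `P i` outside
the support of `G`; then every `f` in `L(G)` has exactly one value in `F` at each `P i`. -/
def agCode {K : Type*} [Field K] [Algebra F K] (P : ι → Place F K) (G : PlaceDivisor F K) :
    Submodule F (ι → F) where
  carrier := {c | ∃ f ∈ riemannRochSpace G, ∀ i, (P i).HasValue f (c i)}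
  zero_mem' := ⟨0, zero_mem _, fun i => by simp [Place.HasValue]⟩
  add_mem' := by
    rintro c d ⟨f, hf, hfc⟩ ⟨g, hg, hgd⟩
    refine ⟨f + g, add_mem hf hg, fun i => ?_⟩
    have := (P i).val.map_add_lt (hfc i) (hgd i)
    rwa [sub_add_sub_comm, ← map_add] at this
  smul_mem' := by
    rintro a c ⟨f, hf, hfc⟩
    refine ⟨a • f, Submodule.smul_mem _ a hf, fun i => ?_⟩
    simp only [Place.HasValue, Pi.smul_apply, smul_eq_mul, map_mul, Algebra.smul_def]
    rw [← mul_sub, map_mul]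
    exact (mul_le_of_le_one_left' ((P i).val_constant_le_one a)).trans_lt (hfc i)

end Codes

/-! ## The rational places of an elliptic curve -/

namespace WeierstrassCurve.Affine

variable {F : Type*} [Field F] (W : Affine F)

/-! ### The point at infinity -/

theorem norm_coordinateRing_ne_zero {f : W.CoordinateRing} (hf : f ≠ 0) :
    Algebra.norm F[X] f ≠ 0 := by
  have : Module.Finite F[X] W.CoordinateRing := .of_basis (CoordinateRing.basis W)
  exact Algebra.norm_ne_zero_iff.2 hf

/-- The pole order at infinity on the affine coordinate ring, as a valuation: a function
`p(X) + q(X) Y` has a pole of order `max (2 deg p) (2 deg q + 3)` at the point at infinity, and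
this number is the degree of its norm down to `F[X]`. -/
noncomputable def infinityValuationAux : Valuation W.CoordinateRing ℤᵐ⁰ where
  toFun f := if f = 0 then 0 else exp ((Algebra.norm F[X] f).natDegree : ℤ)
  map_zero' := by simp
  map_one' := by simp
  map_mul' f g := by
    by_cases hf : f = 0
    · simp [hf]
    by_cases hg : g = 0
    · simp [hg]
    simp only [mul_eq_zero, hf, hg, or_self, if_false, map_mul]
    rw [natDegree_mul (W.norm_coordinateRing_ne_zero hf) (W.norm_coordinateRing_ne_zero hg), Nat.cast_add, exp_add]
  map_add_le_max' f g := by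
    by_cases hf : f = 0
    · simp [hf]
    by_cases hg : g = 0
    · simp [hg]
    by_cases hfg : f + g = 0
    · simp [hfg]
    simp only [hf, hg, hfg, if_false, le_max_iff, exp_le_exp, Nat.cast_le]
    rw [← le_max_iff]
    suffices H : ((Algebra.norm F[X] (f + g)).natDegree : WithBot ℕ) ≤
        max ((Algebra.norm F[X] f).natDegree : WithBot ℕ)
          ((Algebra.norm F[X] g).natDegree : WithBot ℕ) by
      rw [le_max_iff] at H ⊢
      exact H.imp WithBot.coe_le_coe.1 WithBot.coe_le_coe.1
    rw [← degree_eq_natDegree (W.norm_coordinateRing_ne_zero hf),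
      ← degree_eq_natDegree (W.norm_coordinateRing_ne_zero hg),
      ← degree_eq_natDegree (W.norm_coordinateRing_ne_zero hfg)]
    obtain ⟨p, q, rfl⟩ := CoordinateRing.exists_smul_basis_eq f
    obtain ⟨r, s, rfl⟩ := CoordinateRing.exists_smul_basis_eq g
    rw [show p • (1 : W.CoordinateRing) + q • CoordinateRing.mk W Y +
      (r • 1 + s • CoordinateRing.mk W Y) =
      (p + r) • (1 : W.CoordinateRing) + (q + s) • CoordinateRing.mk W Y by
        rw [add_smul, add_smul]; abel]
    simp only [CoordinateRing.degree_norm_smul_basis]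
    have h1 : 2 • (p + r).degree ≤ max (2 • p.degree) (2 • r.degree) := by
      rcases le_max_iff.1 (degree_add_le p r) with h | h
      · exact le_max_of_le_left (nsmul_le_nsmul_right h 2)
      · exact le_max_of_le_right (nsmul_le_nsmul_right h 2)
    have h2 : 2 • (q + s).degree + 3 ≤ max (2 • q.degree + 3) (2 • s.degree + 3) := by
      rcases le_max_iff.1 (degree_add_le q s) with h | h
      · exact le_max_of_le_left (by gcongr)
      · exact le_max_of_le_right (by gcongr)
    refine max_le (h1.trans (max_le ?_ ?_)) (h2.trans (max_le ?_ ?_)) <;> simp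

theorem infinityValuationAux_apply {f : W.CoordinateRing} (hf : f ≠ 0) :
    W.infinityValuationAux f = exp ((Algebra.norm F[X] f).natDegree : ℤ) := if_neg hf

/-- The valuation of the function field at the point at infinity. -/
noncomputable def infinityValuation : Valuation W.FunctionField ℤᵐ⁰ :=
  W.infinityValuationAux.extendToLocalization (S := W.CoordinateRing⁰)
    (fun f hf => by
      have hf0 : f ≠ 0 := nonZeroDivisors.ne_zero hf
      simp [Valuation.mem_supp_iff, Ideal.primeCompl, infinityValuationAux_apply W hf0])
    W.FunctionField

theorem infinityValuation_apply (f : W.CoordinateRing) :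
    W.infinityValuation (algebraMap _ W.FunctionField f) = W.infinityValuationAux f :=
  Valuation.extendToLocalization_apply_map_apply ..

/-- The coordinate function `x`. -/
noncomputable abbrev xFun : W.FunctionField :=
  algebraMap W.CoordinateRing W.FunctionField (CoordinateRing.mk W (C X))

/-- The coordinate function `y`. -/
noncomputable abbrev yFun : W.FunctionField :=
  algebraMap W.CoordinateRing W.FunctionField (CoordinateRing.mk W Y)

theorem infinityValuation_basis (p q : F[X])
    (h : p • (1 : W.CoordinateRing) + q • CoordinateRing.mk W Y ≠ 0) (n : ℕ)
    (hn : max (2 • p.degree) (2 • q.degree + 3) = n) :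
    W.infinityValuation (algebraMap _ W.FunctionField
      (p • (1 : W.CoordinateRing) + q • CoordinateRing.mk W Y)) = exp (n : ℤ) := by
  rw [infinityValuation_apply, infinityValuationAux_apply W h,
    natDegree_eq_of_degree_eq_some ((CoordinateRing.degree_norm_smul_basis p q).trans hn)]

theorem infinityValuation_x : W.infinityValuation W.xFun = exp (2 : ℤ) := by
  have h := W.infinityValuation_basis X 0 ?_ 2 (by simp)
  · rwa [zero_smul, add_zero, CoordinateRing.smul, mul_one] at h
  · intro h
    simpa using (CoordinateRing.smul_basis_eq_zero h).1

theorem infinityValuation_y : W.infinityValuation W.yFun = exp (3 : ℤ) := by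
  have h := W.infinityValuation_basis 0 1 ?_ 3 (by simp)
  · rwa [zero_smul, zero_add, one_smul] at h
  · intro h
    simpa using (CoordinateRing.smul_basis_eq_zero h).2

theorem infinityValuation_constant (c : F) (hc : c ≠ 0) :
    W.infinityValuation (algebraMap F W.FunctionField c) = 1 := by
  have h := W.infinityValuation_basis (C c) 0 ?_ 0 (by simp [degree_C hc])
  · rw [zero_smul, add_zero, CoordinateRing.smul, mul_one] at h
    rw [IsScalarTower.algebraMap_apply F W.CoordinateRing W.FunctionField]
    exact h
  · intro h
    simpa [hc] using (CoordinateRing.smul_basis_eq_zero h).1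

/-- The place of the point at infinity. -/
noncomputable def infinityPlace : Place F W.FunctionField where
  val := W.infinityValuation
  surjective := by
    intro a
    induction a using WithZero.expRecOn with
    | zero => exact ⟨0, map_zero _⟩
    | exp n =>
      refine ⟨(W.yFun / W.xFun) ^ n, ?_⟩
      rw [map_zpow₀, map_div₀, infinityValuation_x, infinityValuation_y, ← exp_sub, ← exp_zsmul]
      simp
  trivial_on_constants := W.infinityValuation_constant

/-! ### The affine points -/

section AffinePoint

variable {W} {x y : F}

theorem xyIdeal_isMaximal (h : W.Nonsingular x y) :
    (CoordinateRing.XYIdeal W x (C y)).IsMaximal :=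
  Ideal.Quotient.maximal_of_isField _ <|
    (CoordinateRing.quotientXYIdealEquiv h.left).toMulEquiv.isField (Field.toIsField F)

theorem xyIdeal_primeCompl_le (h : W.Nonsingular x y) :
    haveI := (xyIdeal_isMaximal h).isPrime
    (CoordinateRing.XYIdeal W x (C y)).primeCompl ≤ W.CoordinateRing⁰ :=
  haveI := (xyIdeal_isMaximal h).isPrime
  Ideal.primeCompl_le_nonZeroDivisors _

/-- The local ring of `W` at a nonsingular affine point `(x, y)`, inside the function field. -/
noncomputable def localRing (h : W.Nonsingular x y) :
    Subalgebra W.CoordinateRing W.FunctionField :=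
  haveI := (xyIdeal_isMaximal h).isPrime
  Localization.subalgebra.ofField W.FunctionField
    (CoordinateRing.XYIdeal W x (C y)).primeCompl (xyIdeal_primeCompl_le h)

instance (h : W.Nonsingular x y) : IsFractionRing (localRing h) W.FunctionField :=
  haveI := (xyIdeal_isMaximal h).isPrime
  Localization.subalgebra.isFractionRing_ofField ..

theorem localRing_isLocalization (h : W.Nonsingular x y) :
    haveI := (xyIdeal_isMaximal h).isPrime
    IsLocalization.AtPrime (localRing h) (CoordinateRing.XYIdeal W x (C y)) :=
  haveI := (xyIdeal_isMaximal h).isPrime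
  Localization.subalgebra.isLocalization_ofField ..

instance localRing_isDiscreteValuationRing (h : W.Nonsingular x y) :
    IsDiscreteValuationRing (localRing h) := by
  have := (xyIdeal_isMaximal h).isPrime
  set I := CoordinateRing.XYIdeal W x (C y) with hI
  have hloc : IsLocalization.AtPrime (localRing h) I := localRing_isLocalization h
  have : IsLocalRing (localRing h) := IsLocalization.AtPrime.isLocalRing _ I
  have : IsNoetherianRing W.CoordinateRing := inferInstance
  have : IsNoetherianRing (localRing h) := IsLocalization.isNoetherianRing I.primeCompl _ this
  have hmax : I.map (algebraMap W.CoordinateRing (localRing h)) =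
      IsLocalRing.maximalIdeal (localRing h) := IsLocalization.AtPrime.map_eq_maximalIdeal I _
  have hinj : Function.Injective (algebraMap W.CoordinateRing (localRing h)) :=
    IsLocalization.injective _ (xyIdeal_primeCompl_le h)
  have hx0 : algebraMap W.CoordinateRing (localRing h) (CoordinateRing.XClass W x) ≠ 0 := by
    rw [Ne, map_eq_zero_iff _ hinj]
    exact CoordinateRing.XClass_ne_zero x
  have hxI : CoordinateRing.XClass W x ∈ I := Ideal.subset_span (by simp)
  have hfield : ¬ IsField (localRing h) := by
    rw [IsLocalRing.isField_iff_maximalIdeal_eq, ← hmax]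
    intro h0
    exact hx0 (by simpa [h0] using Ideal.mem_map_of_mem (algebraMap _ (localRing h)) hxI)
  refine ((IsDiscreteValuationRing.TFAE (localRing h) hfield).out 0 4).2 ?_
  refine Ideal.IsPrincipal.of_finite_maximals_of_isUnit ?_ ?_
  · refine (Set.finite_singleton (IsLocalRing.maximalIdeal (localRing h))).subset fun J hJ => ?_
    exact IsLocalRing.eq_maximalIdeal hJ
  · have hmul := congrArg (Ideal.map (algebraMap W.CoordinateRing (localRing h)))
      (CoordinateRing.XYIdeal_neg_mul h)
    rw [Ideal.map_mul, ← hI, hmax, CoordinateRing.XIdeal, Ideal.map_span, Set.image_singleton,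
      mul_comm] at hmul
    refine isUnit_of_mul_isUnit_left (y := ((CoordinateRing.XYIdeal W x (C (W.negY x y))).map
      (algebraMap W.CoordinateRing (localRing h)) : FractionalIdeal _ _)) ?_
    rw [← FractionalIdeal.coeIdeal_mul, hmul]
    exact .of_mul_eq_one _
      (FractionalIdeal.coe_ideal_span_singleton_mul_inv (FractionRing (localRing h)) hx0)

theorem isUnit_constant_localRing (h : W.Nonsingular x y) (c : F) (hc : c ≠ 0) :
    IsUnit (algebraMap W.CoordinateRing (localRing h) (algebraMap F W.CoordinateRing c)) :=
  ((IsUnit.mk0 c hc).map (algebraMap F W.CoordinateRing)).map _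

/-- The place of a nonsingular affine point `(x, y)`: the order of vanishing at `(x, y)`. -/
noncomputable def affinePlace (h : W.Nonsingular x y) : Place F W.FunctionField where
  val := (IsDiscreteValuationRing.maximalIdeal (localRing h)).valuation W.FunctionField
  surjective := IsDedekindDomain.HeightOneSpectrum.valuation_surjective _ _
  trivial_on_constants := fun c hc => by
    rw [IsScalarTower.algebraMap_apply F W.CoordinateRing W.FunctionField,
      IsScalarTower.algebraMap_apply W.CoordinateRing (localRing h) W.FunctionField,
      IsDedekindDomain.HeightOneSpectrum.valuation_eq_one_iff_notMem]
    exact fun hmem => (IsLocalRing.mem_maximalIdeal _).1 hmem (isUnit_constant_localRing h c hc)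

end AffinePoint

/-- The rational place of the function field that corresponds to a rational point. -/
noncomputable def pointPlace : W.Point → Place F W.FunctionField
  | .zero => W.infinityPlace
  | .some _ _ h => affinePlace h

theorem affinePlace_val_lt_one_of_mem {x y : F} (h : W.Nonsingular x y) {f : W.CoordinateRing}
    (hf : f ∈ CoordinateRing.XYIdeal W x (C y)) :
    (affinePlace h).val (algebraMap W.CoordinateRing W.FunctionField f) < 1 := by
  have := (xyIdeal_isMaximal h).isPrime
  have hloc := localRing_isLocalization h
  rw [IsScalarTower.algebraMap_apply W.CoordinateRing (localRing h) W.FunctionField]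
  refine (IsDedekindDomain.HeightOneSpectrum.valuation_lt_one_iff_mem _ _).2 ?_
  exact (IsLocalization.AtPrime.to_map_mem_maximal_iff (localRing h)
    (CoordinateRing.XYIdeal W x (C y)) f).2 hf

/-- At the place of the point `(x, y)`, the coordinate function `xFun` takes the value `x`. -/
theorem affinePlace_hasValue_x {x y : F} (h : W.Nonsingular x y) :
    (affinePlace h).HasValue W.xFun x := by
  have := affinePlace_val_lt_one_of_mem W h (f := CoordinateRing.XClass W x)
    (Ideal.subset_span (by simp))
  rw [CoordinateRing.XClass, C_sub, map_sub, map_sub] at this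
  exact this

/-- At the place of the point `(x, y)`, the coordinate function `yFun` takes the value `y`. -/
theorem affinePlace_hasValue_y {x y : F} (h : W.Nonsingular x y) :
    (affinePlace h).HasValue W.yFun y := by
  have := affinePlace_val_lt_one_of_mem W h (f := CoordinateRing.YClass W (C y))
    (Ideal.subset_span (by simp))
  rw [CoordinateRing.YClass, map_sub, map_sub] at this
  exact this

end WeierstrassCurve.Affine

/-!
Let `R` be the affine coordinate ring, `K` its fraction field, and `s` a multiset of `k` rational
points, with divisor `G`. Two facts about `L(G)` carry the proof.

* `exists_submodule_le_riemannRochSpace`: `dim L(G) ≥ k` when `k > 0`. Since the ideal of `P` times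
  the ideal of `-P` is generated by the vertical line `x - x_P`, the space `L(G)` contains all `g / d`
  where `d` is the product of the vertical lines through the affine points of `s`, and `g` in `R` has
  bounded pole order at infinity and lies in the product of the ideals of the points `-P`. The
  bound on the pole order leaves an explicit space of polynomials in `x` and `y`, and each point
  imposes at most one linear condition on it.
* `sum_eq_sum_of_vanishing`: if a nonzero `f` in `L(G)` vanishes at `k` distinct points outside `s`,
  then these points have the same sum as `s` in the group law. The fractional ideal `f J`, for `J` the
  product of the ideals of the points of `s`, lies in the product `Z` of the ideals of the zeros;
  comparing degrees gives `f J = Z`, and the ideal class map on points is injective.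

The second fact applies if the evaluation points are taken in a subgroup `H` that does not
contain the sum of `s`: then no nonzero function in `L(G)` vanishes at `k` evaluation points, so any
`k` coordinates determine a codeword. With the first fact and the argument of the Singleton bound this
gives dimension `k` and minimum distance `n - k + 1`, see `isLinearCode_agCode`. For `H` of index two and
`Q` outside `H`, the points `k Q` with `k` odd and `(k - 1) P + Q` with `P` in `H` lie outside `H`.

`L(G)` is defined by conditions at all places of `K`, so the places have to be known: one with a
pole of `x` is the place at infinity (`eq_infinityPlace`), and one whose center on `R` is a rational
point is the place of that point (`eq_affinePlace`); no more is needed about the others than that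
functions in `R` are regular there. Conversely a function regular at all places but infinity lies in
`R`, because `R` is a Dedekind domain. Its integral closedness is descended from the algebraic
closure, where all the nonzero primes are ideals of points and the local rings are discrete
valuation rings.
-/

/-! ### The coordinate ring is a Dedekind domain -/

namespace WeierstrassCurve.Affine

variable {F : Type*} [Field F] {W : Affine F}

instance : Module.Finite F[X] W.CoordinateRing := .of_basis (CoordinateRing.basis W)

theorem isMaximal_of_isPrime_coordinateRing {P : Ideal W.CoordinateRing} (hP : P ≠ ⊥)
    [P.IsPrime] : P.IsMaximal := by
  obtain ⟨f, hfP, hf⟩ := Submodule.exists_mem_ne_zero_of_ne_bot hP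
  have hne : P.comap (algebraMap F[X] W.CoordinateRing) ≠ ⊥ :=
    Ideal.comap_ne_bot_of_integral_mem hf hfP (Algebra.IsIntegral.isIntegral f)
  have := Ideal.IsPrime.isMaximal
    (inferInstance : (P.comap (algebraMap F[X] W.CoordinateRing)).IsPrime) hne
  exact Ideal.isMaximal_of_isIntegral_of_isMaximal_comap P this

/-- Over an algebraically closed field the nonzero primes of the coordinate ring are the ideals of
the points. -/
theorem exists_eq_xyIdeal [IsAlgClosed F] [W.IsElliptic] {P : Ideal W.CoordinateRing}
    (hP : P ≠ ⊥) [hPp : P.IsPrime] :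
    ∃ (x y : F) (_ : W.Nonsingular x y), P = CoordinateRing.XYIdeal W x (C y) := by
  obtain ⟨f, hfP, hf⟩ := Submodule.exists_mem_ne_zero_of_ne_bot hP
  have hne : P.comap (algebraMap F[X] W.CoordinateRing) ≠ ⊥ :=
    Ideal.comap_ne_bot_of_integral_mem hf hfP (Algebra.IsIntegral.isIntegral f)
  have hmax := Ideal.IsPrime.isMaximal
    (inferInstance : (P.comap (algebraMap F[X] W.CoordinateRing)).IsPrime) hne
  obtain ⟨p, hpP, hp⟩ := Submodule.exists_mem_ne_zero_of_ne_bot hne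
  obtain ⟨x, hx⟩ : ∃ x : F, X - C x ∈ P.comap (algebraMap F[X] W.CoordinateRing) := by
    rw [(IsAlgClosed.splits p).eq_prod_roots] at hpP
    rcases hmax.isPrime.mem_or_mem hpP with h | h
    · exact absurd (Ideal.eq_top_of_isUnit_mem _ h
        (isUnit_C.2 (isUnit_iff_ne_zero.2 (leadingCoeff_ne_zero.2 hp)))) hmax.ne_top
    · obtain ⟨q, hq, hqP⟩ := (hmax.isPrime.multiset_prod_mem_iff_exists_mem _).1 h
      obtain ⟨a, -, rfl⟩ := Multiset.mem_map.1 hq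
      exact ⟨a, hqP⟩
  have hX : CoordinateRing.XClass W x ∈ P := hx
  have hdeg : (W.polynomial.map (evalRingHom x)).degree ≠ 0 := by
    rw [monic_polynomial.degree_map, degree_eq_natDegree monic_polynomial.ne_zero,
      natDegree_polynomial]
    decide
  obtain ⟨y, hy⟩ := IsAlgClosed.exists_root _ hdeg
  have hns : W.Nonsingular x y := by
    rwa [IsRoot, map_evalRingHom_eval, ← Equation, equation_iff_nonsingular] at hy
  -- the product of the ideals of a point and of its negative is generated by `X - x`
  have hle : CoordinateRing.XYIdeal W x (C <| W.negY x y) *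
      CoordinateRing.XYIdeal W x (C y) ≤ P := by
    rw [CoordinateRing.XYIdeal_neg_mul hns, CoordinateRing.XIdeal, Ideal.span_singleton_le_iff_mem]
    exact hX
  have hns' : W.Nonsingular x (W.negY x y) := (nonsingular_neg ..).2 hns
  rcases hPp.mul_le.1 hle with h | h
  · exact ⟨x, _, hns', ((xyIdeal_isMaximal hns').eq_of_le hPp.ne_top h).symm⟩
  · exact ⟨x, _, hns, ((xyIdeal_isMaximal hns).eq_of_le hPp.ne_top h).symm⟩

theorem isDedekindDomain_coordinateRing_of_isAlgClosed [IsAlgClosed F] [W.IsElliptic] :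
    IsDedekindDomain W.CoordinateRing := by
  have : IsDedekindDomainDvr W.CoordinateRing :=
    { (inferInstance : IsNoetherianRing W.CoordinateRing) with
      is_dvr_at_nonzero_prime := fun P hP hPp => by
        obtain ⟨x, y, h, rfl⟩ := exists_eq_xyIdeal hP
        have := localRing_isLocalization h
        exact IsDiscreteValuationRing.RingEquivClass.isDiscreteValuationRing
          (IsLocalization.algEquiv (CoordinateRing.XYIdeal W x (C y)).primeCompl (localRing h)
            (Localization.AtPrime (CoordinateRing.XYIdeal W x (C y)))) }
  infer_instance

theorem algebraMap_polynomial_ne_zero {d : F[X]} (hd : d ≠ 0) :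
    algebraMap F[X] W.CoordinateRing d ≠ 0 :=
  (map_ne_zero_iff _ (FaithfulSMul.algebraMap_injective F[X] W.CoordinateRing)).2 hd

theorem algebraMap_functionField_ne_zero {a : W.CoordinateRing} (ha : a ≠ 0) :
    algebraMap W.CoordinateRing W.FunctionField a ≠ 0 :=
  (map_ne_zero_iff _ (IsFractionRing.injective _ _)).2 ha

/-- Every function has a denominator that is a polynomial in `x`. -/
theorem exists_eq_div_polynomial (f : W.FunctionField) :
    ∃ (g : W.CoordinateRing) (d : F[X]), d ≠ 0 ∧
      f = algebraMap W.CoordinateRing W.FunctionField g /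
        algebraMap W.CoordinateRing W.FunctionField (algebraMap F[X] W.CoordinateRing d) := by
  obtain ⟨a, b, hb, rfl⟩ := IsFractionRing.div_surjective W.CoordinateRing f
  have hb0 : b ≠ 0 := nonZeroDivisors.ne_zero hb
  have hne : (Ideal.span {b}).comap (algebraMap F[X] W.CoordinateRing) ≠ ⊥ :=
    Ideal.comap_ne_bot_of_integral_mem hb0 (Ideal.mem_span_singleton_self b)
      (Algebra.IsIntegral.isIntegral b)
  obtain ⟨d, hdb, hd⟩ := Submodule.exists_mem_ne_zero_of_ne_bot hne
  obtain ⟨c, hc⟩ := Ideal.mem_span_singleton.1 (Ideal.mem_comap.1 hdb)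
  have hd0 : algebraMap F[X] W.CoordinateRing d ≠ 0 := algebraMap_polynomial_ne_zero hd
  have hc0 : c ≠ 0 := by
    rintro rfl
    simp_all
  refine ⟨a * c, d, hd, ?_⟩
  rw [hc, map_mul, map_mul, mul_div_mul_right]
  exact algebraMap_functionField_ne_zero hc0

theorem algebraMap_polynomial_mul (d p q : F[X]) :
    algebraMap F[X] W.CoordinateRing d * (p • 1 + q • CoordinateRing.mk W Y) =
      (d * p) • 1 + (d * q) • CoordinateRing.mk W Y := by
  rw [← Algebra.smul_def, smul_add, smul_smul, smul_smul]

theorem smul_basis_inj {p q r s : F[X]}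
    (h : p • (1 : W.CoordinateRing) + q • CoordinateRing.mk W Y =
      r • 1 + s • CoordinateRing.mk W Y) : p = r ∧ q = s := by
  have := CoordinateRing.smul_basis_eq_zero (W' := W) (p := p - r) (q := q - s) (by
    rw [sub_smul, sub_smul]
    linear_combination (exp := 1) h)
  exact ⟨sub_eq_zero.1 this.1, sub_eq_zero.1 this.2⟩

/-- If a fraction is integral, then its denominator divides its numerator over every integrally
closed extension of the ring. -/
theorem map_dvd_map_of_isIntegral {R S K : Type*} [CommRing R] [IsDomain R] [CommRing S]
    [IsDomain S] [IsIntegrallyClosed S] [Field K] [Algebra R K] [IsFractionRing R K]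
    (φ : R →+* S) (hφ : Function.Injective φ) {f : K} (hf : _root_.IsIntegral R f) {a b : R}
    (hab : f * algebraMap R K b = algebraMap R K a) : φ b ∣ φ a := by
  let ψ : K →+* FractionRing S := IsFractionRing.map hφ
  have hψ : ∀ a, ψ (algebraMap _ _ a) = algebraMap _ _ (φ a) := fun a =>
    IsLocalization.map_eq _ a
  have hint : _root_.IsIntegral S (ψ f) :=
    hf.map_of_comp_eq φ ψ (RingHom.ext fun a => (hψ a).symm)
  obtain ⟨r, hr⟩ := IsIntegrallyClosed.isIntegral_iff.1 hint
  refine ⟨r, IsFractionRing.injective S (FractionRing S) ?_⟩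
  rw [← hψ, ← hab, map_mul, ← hr, hψ, map_mul, mul_comm]

/-- Integral closedness descends from the algebraic closure: if `(p + q Y) / d` is integral, then
`d` divides `p` and `q` over the algebraic closure, hence over `F`. -/
instance isIntegrallyClosed_coordinateRing [W.IsElliptic] :
    IsIntegrallyClosed W.CoordinateRing := by
  refine (isIntegrallyClosed_iff W.FunctionField).2 fun {f} hf => ?_
  obtain ⟨g, d, hd, hfgd⟩ := exists_eq_div_polynomial f
  have hd0 := algebraMap_functionField_ne_zero (algebraMap_polynomial_ne_zero (W := W) hd)
  obtain ⟨p, q, rfl⟩ := CoordinateRing.exists_smul_basis_eq g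
  let i : F →+* AlgebraicClosure F := algebraMap F (AlgebraicClosure F)
  have : (W.map i).IsElliptic := inferInstance
  have : IsDedekindDomain (W.map i).toAffine.CoordinateRing :=
    isDedekindDomain_coordinateRing_of_isAlgClosed
  obtain ⟨r, hr⟩ := map_dvd_map_of_isIntegral (CoordinateRing.map W i)
    (CoordinateRing.map_injective i.injective) hf ((eq_div_iff hd0).1 hfgd)
  obtain ⟨p', q', rfl⟩ := CoordinateRing.exists_smul_basis_eq r
  rw [Algebra.algebraMap_eq_smul_one, map_add, CoordinateRing.map_smul, CoordinateRing.map_smul,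
    CoordinateRing.map_smul, map_one, CoordinateRing.map_mk, map_X,
    ← Algebra.algebraMap_eq_smul_one (d.map i), algebraMap_polynomial_mul] at hr
  obtain ⟨h1, h2⟩ := smul_basis_inj hr
  obtain ⟨p₀, rfl⟩ := (map_dvd_map' i).1 ⟨p', h1⟩
  obtain ⟨q₀, rfl⟩ := (map_dvd_map' i).1 ⟨q', h2⟩
  refine ⟨p₀ • 1 + q₀ • CoordinateRing.mk W Y, ?_⟩
  rw [hfgd, eq_div_iff hd0, ← map_mul, mul_comm, algebraMap_polynomial_mul]

instance isDedekindDomain_coordinateRing [W.IsElliptic] :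
    IsDedekindDomain W.CoordinateRing :=
  have : Ring.DimensionLEOne W.CoordinateRing :=
    ⟨fun hP _ => isMaximal_of_isPrime_coordinateRing hP⟩
  have : IsDedekindRing W.CoordinateRing :=
    { (inferInstance : IsNoetherianRing W.CoordinateRing), this,
      isIntegrallyClosed_coordinateRing with }
  { this with }

end WeierstrassCurve.Affine

/-! ### The place at infinity -/

instance Place.isTrivialOn {F K : Type*} [Field F] [Field K] [Algebra F K] (v : Place F K) :
    v.val.IsTrivialOn F := ⟨v.trivial_on_constants⟩

namespace WeierstrassCurve.Affine

variable {F : Type*} [Field F] {W : Affine F}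

theorem algebraMap_polynomial (p : F[X]) :
    algebraMap W.CoordinateRing W.FunctionField (algebraMap F[X] W.CoordinateRing p) =
      aeval W.xFun p := by
  rw [show W.xFun = algebraMap W.CoordinateRing W.FunctionField (algebraMap F[X] W.CoordinateRing X)
    from rfl, aeval_algebraMap_apply, aeval_algebraMap_apply, aeval_X_left_apply]

theorem algebraMap_smul_basis (p q : F[X]) :
    algebraMap W.CoordinateRing W.FunctionField (p • 1 + q • CoordinateRing.mk W Y) =
      aeval W.xFun p + aeval W.xFun q * W.yFun := by
  rw [Algebra.smul_def, Algebra.smul_def, mul_one, map_add, map_mul, algebraMap_polynomial,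
    algebraMap_polynomial]

variable (W) in
theorem yFun_sq : W.yFun ^ 2 = aeval W.xFun (X ^ 3 + C W.a₂ * X ^ 2 + C W.a₄ * X + C W.a₆) -
    aeval W.xFun (C W.a₁ * X + C W.a₃) * W.yFun := by
  have h : CoordinateRing.mk W (Y ^ 2 + C (C W.a₁ * X + C W.a₃) * Y -
      C (X ^ 3 + C W.a₂ * X ^ 2 + C W.a₄ * X + C W.a₆)) = 0 := AdjoinRoot.mk_self
  have h' := congrArg (algebraMap W.CoordinateRing W.FunctionField) h
  rw [map_sub, map_add, map_mul, map_pow, map_sub, map_add, map_mul, map_pow, map_zero] at h'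
  have hC (p : F[X]) : algebraMap F[X] W.CoordinateRing p = CoordinateRing.mk W (C p) := rfl
  rw [← algebraMap_polynomial, ← algebraMap_polynomial, hC, hC]
  linear_combination h'

variable (v : Place F W.FunctionField)

theorem val_aeval_le_one (hx : v.val W.xFun ≤ 1) (p : F[X]) : v.val (aeval W.xFun p) ≤ 1 := by
  rw [aeval_eq_sum_range]
  refine v.val.map_sum_le fun i _ => ?_
  rw [Algebra.smul_def, map_mul, map_pow]
  exact mul_le_one' (v.val_constant_le_one _) (pow_le_one' hx _)

theorem val_y_le_one (hx : v.val W.xFun ≤ 1) : v.val W.yFun ≤ 1 := by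
  by_contra! hy
  have h : v.val (W.yFun ^ 2) ≤ v.val W.yFun := by
    rw [yFun_sq]
    refine v.val.map_sub_le ((val_aeval_le_one v hx _).trans hy.le) ?_
    rw [map_mul]
    exact mul_le_of_le_one_left' (val_aeval_le_one v hx _)
  rw [map_pow, sq] at h
  exact h.not_gt (lt_mul_of_one_lt_left (zero_lt_one.trans hy) hy)

theorem val_algebraMap_le_one (hx : v.val W.xFun ≤ 1) (f : W.CoordinateRing) :
    v.val (algebraMap _ W.FunctionField f) ≤ 1 := by
  obtain ⟨p, q, rfl⟩ := CoordinateRing.exists_smul_basis_eq f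
  rw [algebraMap_smul_basis]
  refine v.val.map_add_le (val_aeval_le_one v hx _) ?_
  rw [map_mul]
  exact mul_le_one' (val_aeval_le_one v hx _) (val_y_le_one v hx)

/-- At a pole of `x` the pole orders of `x` and `y` are `2 m` and `3 m`. -/
theorem exists_val_x_val_y (hx : 1 < v.val W.xFun) :
    ∃ m : ℕ, 0 < m ∧ v.val W.xFun = exp (2 * m : ℤ) ∧ v.val W.yFun = exp (3 * m : ℤ) := by
  have hp {p : F[X]} (hp : p ≠ 0) : v.val (aeval W.xFun p) = v.val W.xFun ^ p.natDegree :=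
    Polynomial.valuation_aeval_eq_valuation_X_pow_natDegree_of_one_lt_valuation_X _ hx hp
  set p₃ : F[X] := X ^ 3 + C W.a₂ * X ^ 2 + C W.a₄ * X + C W.a₆ with hp₃
  have hdeg : p₃.natDegree = 3 := by rw [hp₃]; compute_degree!
  have h3 : v.val (aeval W.xFun p₃) = v.val W.xFun ^ 3 := by
    rw [hp, hdeg]
    rintro h
    simp [h] at hdeg
  have h1 : v.val (aeval W.xFun (C W.a₁ * X + C W.a₃)) ≤ v.val W.xFun := by
    by_cases h0 : C W.a₁ * X + C W.a₃ = 0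
    · simp [h0]
    · rw [hp h0]
      exact (pow_le_pow_right₀ hx.le natDegree_linear_le).trans (pow_one _).le
  set L := aeval W.xFun (C W.a₁ * X + C W.a₃) with hL
  have heq : W.yFun ^ 2 + L * W.yFun = aeval W.xFun p₃ := by rw [yFun_sq, sub_add_cancel]
  set a := v.val W.xFun with ha
  set c := v.val W.yFun with hc
  have ha0 : 0 < a := zero_lt_one.trans hx
  -- otherwise the left side of `heq` has valuation at most `a ^ 2`, the right side `a ^ 3`
  have hac : a < c := by
    by_contra! hca
    have : v.val (W.yFun ^ 2 + L * W.yFun) ≤ a ^ 2 := by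
      refine v.val.map_add_le ?_ ?_
      · rw [map_pow]
        exact pow_le_pow_left₀ zero_le hca 2
      · rw [map_mul, sq]
        exact mul_le_mul' h1 hca
    rw [heq, h3] at this
    exact this.not_gt (pow_lt_pow_right₀ hx (by norm_num))
  have hc0 : 0 < c := ha0.trans hac
  have hsq : c ^ 2 = a ^ 3 := by
    rw [← h3, ← heq, Valuation.map_add_eq_of_lt_left, map_pow]
    rw [map_mul, map_pow, sq]
    exact (mul_le_mul_left h1 c).trans_lt (mul_lt_mul_of_pos_right hac hc0)
  have hlog := congrArg log hsq
  rw [log_pow, log_pow, nsmul_eq_mul, nsmul_eq_mul] at hlog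
  have hpos : 0 < log a := by
    rw [← log_one, log_lt_log one_ne_zero ha0.ne']
    exact hx
  refine ⟨(log c - log a).toNat, ?_, ?_, ?_⟩
  · omega
  · rw [← exp_log ha0.ne']
    congr 1
    simp only [log_exp]
    omega
  · rw [← exp_log hc0.ne']
    congr 1
    simp only [log_exp]
    omega

/-- At a pole of `x` the terms of `p(x) + q(x) y` have different pole orders, so the place is
determined up to a power, and being normalized it is the place at infinity. -/
theorem eq_infinityPlace (hx : 1 < v.val W.xFun) : v = W.infinityPlace := by
  obtain ⟨m, hm, hvx, hvy⟩ := exists_val_x_val_y v hx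
  have hp {p : F[X]} (hp : p ≠ 0) : v.val (aeval W.xFun p) = exp (m * (2 * p.natDegree) : ℤ) := by
    rw [Polynomial.valuation_aeval_eq_valuation_X_pow_natDegree_of_one_lt_valuation_X _ hx hp, hvx,
      ← exp_nsmul]
    congr 1
    rw [nsmul_eq_mul]
    ring
  have hq {q : F[X]} (hq : q ≠ 0) : v.val (aeval W.xFun q * W.yFun) =
      exp (m * (2 * q.natDegree + 3) : ℤ) := by
    rw [map_mul, hp hq, hvy, ← exp_add]
    congr 1
    ring
  have hR (f : W.CoordinateRing) : v.val (algebraMap _ W.FunctionField f) =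
      W.infinityValuation (algebraMap _ W.FunctionField f) ^ m := by
    by_cases hf : f = 0
    · simp [hf, hm.ne']
    obtain ⟨p, q, rfl⟩ := CoordinateRing.exists_smul_basis_eq f
    have key (n : ℕ) (hn : max (2 • p.degree) (2 • q.degree + 3) = n)
        (hv : v.val (aeval W.xFun p + aeval W.xFun q * W.yFun) = exp (m * n : ℤ)) :
        v.val (algebraMap _ W.FunctionField (p • 1 + q • CoordinateRing.mk W Y)) =
          W.infinityValuation
            (algebraMap _ W.FunctionField (p • 1 + q • CoordinateRing.mk W Y)) ^ m := by
      rw [W.infinityValuation_basis p q hf n hn, algebraMap_smul_basis, hv, ← exp_nsmul,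
        nsmul_eq_mul]
    by_cases hp0 : p = 0
    · have hq0 : q ≠ 0 := by
        rintro rfl
        simp [hp0] at hf
      refine key (2 * q.natDegree + 3) ?_ ?_
      · simp [hp0, degree_eq_natDegree hq0]
      · rw [hp0, map_zero, zero_add, hq hq0]
        push_cast
        rfl
    by_cases hq0 : q = 0
    · refine key (2 * p.natDegree) ?_ ?_
      · simp [hq0, degree_eq_natDegree hp0]
      · rw [hq0, map_zero, zero_mul, add_zero, hp hp0]
        push_cast
        rfl
    have hdeg : max (2 • p.degree) (2 • q.degree + 3) =
        ((max (2 * p.natDegree) (2 * q.natDegree + 3) : ℕ) : WithBot ℕ) := by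
      rw [degree_eq_natDegree hp0, degree_eq_natDegree hq0]
      rw [(Nat.mono_cast (α := WithBot ℕ)).map_max]
      push_cast
      simp
    refine key _ hdeg ?_
    -- an even and an odd number
    rcases lt_or_gt_of_ne (show 2 * p.natDegree ≠ 2 * q.natDegree + 3 by omega) with h | h
    · rw [Valuation.map_add_eq_of_lt_right, hq hq0, max_eq_right h.le]
      · push_cast
        rfl
      · rw [hp hp0, hq hq0, exp_lt_exp]
        exact mul_lt_mul_of_pos_left (by exact_mod_cast h) (by exact_mod_cast hm)
    · rw [Valuation.map_add_eq_of_lt_left, hp hp0, max_eq_left h.le]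
      · push_cast
        rfl
      · rw [hp hp0, hq hq0, exp_lt_exp]
        exact mul_lt_mul_of_pos_left (by exact_mod_cast h) (by exact_mod_cast hm)
  have hK (f : W.FunctionField) : v.val f = W.infinityValuation f ^ m := by
    obtain ⟨a, b, -, rfl⟩ := IsFractionRing.div_surjective W.CoordinateRing f
    rw [map_div₀, map_div₀, hR, hR, div_pow]
  -- the valuation is surjective, so it is not a proper power of another one
  have hm1 : m = 1 := by
    obtain ⟨f, hf⟩ := v.surjective (exp 1)
    have h := congrArg log ((hK f).symm.trans hf)
    rw [log_pow, log_exp, nsmul_eq_mul] at h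
    have := Int.isUnit_iff.1 (IsUnit.of_mul_eq_one _ h)
    omega
  ext f
  rw [hK, hm1, pow_one]
  rfl

theorem val_x_le_one (hv : v ≠ W.infinityPlace) : v.val W.xFun ≤ 1 := by
  by_contra! h
  exact hv (eq_infinityPlace v h)

end WeierstrassCurve.Affine

/-! ### The places of affine points and the values of functions -/

theorem Place.HasValue.unique {F K : Type*} [Field F] [Field K] [Algebra F K] {v : Place F K}
    {f : K} {c d : F} (hc : v.HasValue f c) (hd : v.HasValue f d) : c = d := by
  by_contra h
  have hlt := v.val.map_sub_lt hc hd
  rw [sub_sub_sub_cancel_left, ← map_sub,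
    v.trivial_on_constants _ (sub_ne_zero.2 (Ne.symm h))] at hlt
  exact hlt.false

theorem Place.HasValue.val_le_one {F K : Type*} [Field F] [Field K] [Algebra F K] {v : Place F K}
    {f : K} {c : F} (hc : v.HasValue f c) : v.val f ≤ 1 := by
  have := v.val.map_add_le hc.le (v.val_constant_le_one c)
  rwa [sub_add_cancel] at this

namespace WeierstrassCurve.Affine

variable {F : Type*} [Field F] {W : Affine F} {x y : F}

theorem affinePlace_val_eq_one (h : W.Nonsingular x y) {f : W.CoordinateRing}
    (hf : f ∉ CoordinateRing.XYIdeal W x (C y)) :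
    (affinePlace h).val (algebraMap W.CoordinateRing W.FunctionField f) = 1 := by
  have := (xyIdeal_isMaximal h).isPrime
  have hloc := localRing_isLocalization h
  rw [IsScalarTower.algebraMap_apply W.CoordinateRing (localRing h) W.FunctionField]
  refine (IsDedekindDomain.HeightOneSpectrum.valuation_eq_one_iff_notMem ..).2 fun hmem => hf ?_
  exact (IsLocalization.AtPrime.to_map_mem_maximal_iff (localRing h)
    (CoordinateRing.XYIdeal W x (C y)) f).1 hmem

theorem exists_eq_div_of_affinePlace_val_le_one (h : W.Nonsingular x y) {f : W.FunctionField}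
    (hf : (affinePlace h).val f ≤ 1) : ∃ a s : W.CoordinateRing,
      s ∉ CoordinateRing.XYIdeal W x (C y) ∧
      f = algebraMap _ W.FunctionField a / algebraMap _ W.FunctionField s := by
  obtain ⟨⟨_, a, s, hs, rfl⟩, rfl⟩ := IsDiscreteValuationRing.exists_lift_of_le_one hf
  exact ⟨a, s, hs, rfl⟩

theorem exists_uniformizer (h : W.Nonsingular x y) :
    ∃ a ∈ CoordinateRing.XYIdeal W x (C y),
      (affinePlace h).val (algebraMap _ W.FunctionField a) = exp (-1 : ℤ) := by
  obtain ⟨f, hf⟩ := (affinePlace h).surjective (exp (-1 : ℤ))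
  have hlt : exp (-1 : ℤ) < 1 := by
    rw [← exp_zero, exp_lt_exp]
    norm_num
  obtain ⟨a, s, hs, rfl⟩ := exists_eq_div_of_affinePlace_val_le_one h (hf.trans_lt hlt).le
  rw [map_div₀, affinePlace_val_eq_one h hs, div_one] at hf
  refine ⟨a, ?_, hf⟩
  by_contra ha
  rw [affinePlace_val_eq_one h ha] at hf
  exact hlt.ne hf.symm

/-- If the center of a place contains the ideal of a point, then it is equal to it. -/
theorem val_algebraMap_eq_one {v : Place F W.FunctionField} (h : W.Nonsingular x y)
    (hx : v.val W.xFun ≤ 1)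
    (hv : ∀ a ∈ CoordinateRing.XYIdeal W x (C y), v.val (algebraMap _ W.FunctionField a) < 1)
    {s : W.CoordinateRing} (hs : s ∉ CoordinateRing.XYIdeal W x (C y)) :
    v.val (algebraMap _ W.FunctionField s) = 1 := by
  refine (val_algebraMap_le_one v hx s).antisymm (le_of_not_gt fun hlt => ?_)
  obtain ⟨b, c, hc, hbc⟩ := (xyIdeal_isMaximal h).exists_inv hs
  have := v.val.map_add_lt (x := algebraMap _ W.FunctionField (b * s))
    (y := algebraMap _ W.FunctionField c)
    (g := 1) ?_ (hv c hc)
  · rw [← map_add, hbc, map_one, map_one] at this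
    exact this.false
  · rw [map_mul, map_mul]
    exact mul_lt_one_of_nonneg_of_lt_one_right (val_algebraMap_le_one v hx b) zero_le hlt

/-- A place centered at an affine point is the place of that point: writing a function as a power
of a uniformizer times a unit of the local ring shows that the two valuations are proportional. -/
theorem eq_affinePlace {v : Place F W.FunctionField} (h : W.Nonsingular x y)
    (hx : v.val W.xFun ≤ 1)
    (hv : ∀ a ∈ CoordinateRing.XYIdeal W x (C y), v.val (algebraMap _ W.FunctionField a) < 1) :
    v = affinePlace h := by
  obtain ⟨t, ht, hwt⟩ := exists_uniformizer h
  set τ := algebraMap _ W.FunctionField t with hτ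
  have hτ0 : τ ≠ 0 := by
    intro h0
    rw [h0, map_zero] at hwt
    exact exp_ne_zero hwt.symm
  have key {f : W.FunctionField} (hf : f ≠ 0) : v.val f = v.val τ ^ (-log ((affinePlace h).val f)) := by
    set n := log ((affinePlace h).val f) with hn
    have hunit : (affinePlace h).val (f * τ ^ n) = 1 := by
      rw [map_mul, map_zpow₀, hwt, ← exp_zsmul,
        ← exp_log (((affinePlace h).val.ne_zero_iff).2 hf), ← exp_add, ← hn]
      simp
    obtain ⟨a, s, hs, has⟩ := exists_eq_div_of_affinePlace_val_le_one h hunit.le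
    have ha : a ∉ CoordinateRing.XYIdeal W x (C y) := by
      intro ha
      rw [has, map_div₀, affinePlace_val_eq_one h hs, div_one] at hunit
      exact (affinePlace_val_lt_one_of_mem W h ha).ne hunit
    have hv1 : v.val (f * τ ^ n) = 1 := by
      rw [has, map_div₀, val_algebraMap_eq_one h hx hv hs, val_algebraMap_eq_one h hx hv ha,
        div_one]
    rw [map_mul, map_zpow₀] at hv1
    rw [zpow_neg]
    exact eq_inv_of_mul_eq_one_left hv1
  have hvτ : v.val τ = exp (-1 : ℤ) := by
    obtain ⟨g, hg⟩ := v.surjective (exp (1 : ℤ))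
    have hg0 : g ≠ 0 := by
      rintro rfl
      rw [map_zero] at hg
      exact exp_ne_zero hg.symm
    have hlog := congrArg log ((key hg0).symm.trans hg)
    rw [log_zpow, log_exp, smul_eq_mul] at hlog
    have hneg : log (v.val τ) < 0 := by
      rw [← log_one, log_lt_log ((v.val.ne_zero_iff).2 hτ0) one_ne_zero]
      exact hv t ht
    rcases Int.isUnit_iff.1 (IsUnit.of_mul_eq_one_right _ hlog) with h1 | h1
    · omega
    · rw [← h1, exp_log ((v.val.ne_zero_iff).2 hτ0)]
  ext f
  by_cases hf : f = 0
  · simp [hf]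
  · rw [key hf, hvτ, ← exp_zsmul, smul_eq_mul, neg_mul_neg, mul_one,
      exp_log ((Valuation.ne_zero_iff _).2 hf)]

theorem affinePlace_ne_infinityPlace (h : W.Nonsingular x y) : affinePlace h ≠ W.infinityPlace := by
  intro heq
  have h1 := (affinePlace_hasValue_x W h).val_le_one
  have h2 : W.infinityPlace.val W.xFun = exp (2 : ℤ) := W.infinityValuation_x
  rw [heq, h2, ← exp_zero, exp_le_exp] at h1
  norm_num at h1

theorem pointPlace_injective : Function.Injective W.pointPlace := by
  rintro (_ | ⟨x, y, h⟩) (_ | ⟨x', y', h'⟩) heq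
  · rfl
  · exact absurd heq.symm (affinePlace_ne_infinityPlace h')
  · exact absurd heq (affinePlace_ne_infinityPlace h)
  · change affinePlace h = affinePlace h' at heq
    have hx := affinePlace_hasValue_x W h
    have hy := affinePlace_hasValue_y W h
    rw [heq] at hx hy
    obtain rfl := hx.unique (affinePlace_hasValue_x W h')
    obtain rfl := hy.unique (affinePlace_hasValue_y W h')
    rfl

theorem exists_sub_algebraMap_mem {x y : F} (h : W.Nonsingular x y) (a : W.CoordinateRing) :
    ∃ c : F, a - algebraMap F W.CoordinateRing c ∈ CoordinateRing.XYIdeal W x (C y) := by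
  let e := CoordinateRing.quotientXYIdealEquiv h.left
  refine ⟨e (Ideal.Quotient.mk _ a), Ideal.Quotient.eq.1 (e.injective ?_)⟩
  exact (e.commutes (e (Ideal.Quotient.mk _ a))).symm

theorem exists_hasValue_affinePlace (h : W.Nonsingular x y) {f : W.FunctionField}
    (hf : (affinePlace h).val f ≤ 1) : ∃ c, (affinePlace h).HasValue f c := by
  obtain ⟨a, s, hs, rfl⟩ := exists_eq_div_of_affinePlace_val_le_one h hf
  obtain ⟨c, hc⟩ := exists_sub_algebraMap_mem h a
  obtain ⟨d, hd⟩ := exists_sub_algebraMap_mem h s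
  have hd0 : d ≠ 0 := by
    rintro rfl
    rw [map_zero, sub_zero] at hd
    exact hs hd
  have hs0 : algebraMap W.CoordinateRing W.FunctionField s ≠ 0 := by
    refine algebraMap_functionField_ne_zero ?_
    rintro rfl
    exact hs (zero_mem _)
  refine ⟨c / d, ?_⟩
  have hmem : a - algebraMap F W.CoordinateRing (c / d) * s ∈ CoordinateRing.XYIdeal W x (C y) := by
    have : a - algebraMap F W.CoordinateRing (c / d) * s = (a - algebraMap F _ c) -
        algebraMap F W.CoordinateRing (c / d) * (s - algebraMap F _ d) := by
      rw [mul_sub, ← map_mul, div_mul_cancel₀ _ hd0]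
      ring
    rw [this]
    exact sub_mem hc (Ideal.mul_mem_left _ _ hd)
  have := affinePlace_val_lt_one_of_mem W h hmem
  have hsub : algebraMap _ W.FunctionField a / algebraMap _ W.FunctionField s -
      algebraMap F W.FunctionField (c / d) = algebraMap _ W.FunctionField
        (a - algebraMap F W.CoordinateRing (c / d) * s) / algebraMap _ W.FunctionField s := by
    rw [map_sub, map_mul, ← IsScalarTower.algebraMap_apply F W.CoordinateRing W.FunctionField,
      sub_div, mul_div_cancel_right₀ _ hs0]
  rwa [Place.HasValue, hsub, map_div₀, affinePlace_val_eq_one h hs, div_one]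

theorem infinityValuation_le_exp_iff (f : W.CoordinateRing) (n : ℕ) :
    W.infinityValuation (algebraMap _ W.FunctionField f) ≤ exp (n : ℤ) ↔
      (Algebra.norm F[X] f).degree ≤ n := by
  by_cases hf : f = 0
  · simp [hf]
  · rw [infinityValuation_apply, infinityValuationAux_apply W hf, exp_le_exp, Nat.cast_le,
      degree_eq_natDegree (W.norm_coordinateRing_ne_zero hf), Nat.cast_le]

theorem infinityValuation_lt_exp_iff (f : W.CoordinateRing) (n : ℕ) :
    W.infinityValuation (algebraMap _ W.FunctionField f) < exp (n : ℤ) ↔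
      (Algebra.norm F[X] f).degree < n := by
  by_cases hf : f = 0
  · simp [hf]
  · rw [infinityValuation_apply, infinityValuationAux_apply W hf, exp_lt_exp, Nat.cast_lt,
      degree_eq_natDegree (W.norm_coordinateRing_ne_zero hf), Nat.cast_lt]

theorem infinityValuation_polynomial {d : F[X]} (hd : d ≠ 0) :
    W.infinityValuation (algebraMap _ W.FunctionField (algebraMap F[X] W.CoordinateRing d)) =
      exp ((2 * d.natDegree : ℕ) : ℤ) := by
  have hne : d • (1 : W.CoordinateRing) + (0 : F[X]) • CoordinateRing.mk W Y ≠ 0 := by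
    rw [zero_smul, add_zero, ← Algebra.algebraMap_eq_smul_one]
    exact algebraMap_polynomial_ne_zero hd
  have := W.infinityValuation_basis d 0 hne (2 * d.natDegree) (by simp [degree_eq_natDegree hd])
  rwa [zero_smul, add_zero, ← Algebra.algebraMap_eq_smul_one] at this

/-- A function `(p + q y) / d` that is regular at infinity takes there the quotient of the
coefficients of `p` and `d` in degree `deg d`; the term `q y` does not contribute, its pole order
being odd before division by `d`. -/
theorem exists_hasValue_infinityPlace {f : W.FunctionField}
    (hf : W.infinityPlace.val f ≤ 1) : ∃ c, W.infinityPlace.HasValue f c := by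
  obtain ⟨g, d, hd, rfl⟩ := exists_eq_div_polynomial f
  obtain ⟨p, q, rfl⟩ := CoordinateRing.exists_smul_basis_eq g
  have hd0 := algebraMap_functionField_ne_zero (algebraMap_polynomial_ne_zero (W := W) hd)
  change W.infinityValuation _ ≤ 1 at hf
  have hpos : (0 : ℤᵐ⁰) < exp ((2 * d.natDegree : ℕ) : ℤ) := exp_pos
  rw [map_div₀, infinityValuation_polynomial hd, div_le_one₀ hpos, infinityValuation_le_exp_iff,
    CoordinateRing.degree_norm_smul_basis, max_le_iff] at hf
  set n := d.natDegree with hn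
  set c := p.coeff n / d.coeff n with hc
  refine ⟨c, ?_⟩
  have hsub : algebraMap _ W.FunctionField (p • 1 + q • CoordinateRing.mk W Y) /
      algebraMap _ W.FunctionField (algebraMap F[X] W.CoordinateRing d) -
      algebraMap F W.FunctionField c =
      algebraMap _ W.FunctionField ((p - C c * d) • 1 + q • CoordinateRing.mk W Y) /
        algebraMap _ W.FunctionField (algebraMap F[X] W.CoordinateRing d) := by
    rw [sub_eq_iff_eq_add, div_add' _ _ _ hd0, algebraMap_polynomial, algebraMap_smul_basis,
      algebraMap_smul_basis, map_sub, map_mul, aeval_C]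
    ring
  change W.infinityValuation _ < 1
  rw [hsub, map_div₀, infinityValuation_polynomial hd, div_lt_one₀ hpos,
    infinityValuation_lt_exp_iff, CoordinateRing.degree_norm_smul_basis, max_lt_iff]
  constructor
  · have hdeg : (p - C c * d).degree < n := by
      rw [degree_lt_iff_coeff_zero]
      intro i hi
      rcases hi.eq_or_lt with rfl | hi
      · rw [coeff_sub, coeff_C_mul, hc, div_mul_cancel₀, sub_self]
        exact leadingCoeff_ne_zero.2 hd
      · have hpi : p.coeff i = 0 := by
          by_contra hp
          have h1 := (nsmul_le_nsmul_right (le_degree_of_ne_zero hp) 2).trans hf.1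
          rw [nsmul_eq_mul] at h1
          norm_cast at h1
          omega
        rw [coeff_sub, coeff_C_mul, hpi, coeff_eq_zero_of_natDegree_lt hi, mul_zero, sub_zero]
    by_cases h0 : p - C c * d = 0
    · rw [h0, degree_zero, two_nsmul, WithBot.bot_add]
      exact bot_lt_iff_ne_bot.2 (WithBot.natCast_ne_bot _)
    · rw [degree_eq_natDegree h0, nsmul_eq_mul] at *
      norm_cast at *
      omega
  · by_cases h0 : q = 0
    · rw [h0, degree_zero, two_nsmul, WithBot.bot_add, WithBot.bot_add]
      exact bot_lt_iff_ne_bot.2 (WithBot.natCast_ne_bot _)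
    · have h2 := hf.2
      rw [degree_eq_natDegree h0, nsmul_eq_mul] at *
      norm_cast at *
      omega

theorem exists_hasValue_pointPlace (P : W.Point) {f : W.FunctionField}
    (hf : (W.pointPlace P).val f ≤ 1) : ∃ c, (W.pointPlace P).HasValue f c := by
  rcases P with _ | ⟨x, y, h⟩
  · exact exists_hasValue_infinityPlace hf
  · exact exists_hasValue_affinePlace h hf

end WeierstrassCurve.Affine

/-! ### Divisors of points and the corresponding ideals -/

namespace WeierstrassCurve.Affine

variable {F : Type*} [Field F] {W : Affine F}

/-- The ideal of the coordinate ring of the functions vanishing at a point; the point at infinity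
imposes no condition. -/
noncomputable def pointIdeal : W.Point → Ideal W.CoordinateRing
  | .zero => ⊤
  | .some x y _ => CoordinateRing.XYIdeal W x (C y)

/-- The degree of the affine part of the divisor of a point: `0` at infinity, otherwise `1`. -/
def affineDegree : W.Point → ℕ
  | .zero => 0
  | .some _ _ _ => 1

/-- A polynomial in `x` with divisor `P + (-P) - 2 O`. -/
noncomputable def verticalLine : W.Point → F[X]
  | .zero => 1
  | .some x _ _ => X - C x

/-- The effective divisor that is the sum of the points of a multiset. -/
noncomputable def pointDivisor (s : Multiset W.Point) : PlaceDivisor F W.FunctionField :=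
  (s.map fun P => Finsupp.single (W.pointPlace P) 1).sum

/-- The ideal of the affine part of the divisor `pointDivisor s`. -/
noncomputable def divisorIdeal (s : Multiset W.Point) : Ideal W.CoordinateRing :=
  (s.map pointIdeal).prod

/-- The degree of the affine part of the divisor `pointDivisor s`. -/
def divisorAffineDegree (s : Multiset W.Point) : ℕ :=
  (s.map affineDegree).sum

/-- A polynomial in `x` whose affine zeros are the points of `s` and their negatives. -/
noncomputable def verticalLines (s : Multiset W.Point) : F[X] :=
  (s.map verticalLine).prod

@[simp] theorem pointDivisor_zero : pointDivisor (0 : Multiset W.Point) = 0 := by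
  simp [pointDivisor]

@[simp] theorem pointDivisor_cons (P : W.Point) (s : Multiset W.Point) :
    pointDivisor (P ::ₘ s) = Finsupp.single (W.pointPlace P) 1 + pointDivisor s := by
  simp [pointDivisor]

@[simp] theorem divisorIdeal_zero : divisorIdeal (0 : Multiset W.Point) = ⊤ := by
  simp [divisorIdeal]

@[simp] theorem divisorIdeal_cons (P : W.Point) (s : Multiset W.Point) :
    divisorIdeal (P ::ₘ s) = pointIdeal P * divisorIdeal s := by
  simp [divisorIdeal]

@[simp] theorem divisorAffineDegree_zero : divisorAffineDegree (0 : Multiset W.Point) = 0 := by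
  simp [divisorAffineDegree]

@[simp] theorem divisorAffineDegree_cons (P : W.Point) (s : Multiset W.Point) :
    divisorAffineDegree (P ::ₘ s) = affineDegree P + divisorAffineDegree s := by
  simp [divisorAffineDegree]

theorem divisorAffineDegree_map_neg (s : Multiset W.Point) :
    divisorAffineDegree (s.map (- ·)) = divisorAffineDegree s := by
  induction s using Multiset.induction with
  | empty => simp
  | cons P s ih =>
    rw [Multiset.map_cons, divisorAffineDegree_cons, divisorAffineDegree_cons, ih]
    rcases P with _ | _ <;> rfl

/-- The degree of the divisor of `s`, split into the affine part and the part at infinity. -/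
theorem pointDivisor_infinityPlace (s : Multiset W.Point) :
    (divisorAffineDegree s : ℤ) + pointDivisor s W.infinityPlace = s.card := by
  induction s using Multiset.induction with
  | empty => simp
  | cons P s ih =>
    rw [divisorAffineDegree_cons, pointDivisor_cons, Finsupp.add_apply, Multiset.card_cons]
    push_cast
    rw [← ih]
    rcases P with _ | ⟨x, y, h⟩
    · rw [show W.pointPlace .zero = W.infinityPlace from rfl, Finsupp.single_eq_same]
      simp only [affineDegree]
      ring
    · rw [show W.pointPlace (.some x y h) = affinePlace h from rfl,
        Finsupp.single_eq_of_ne (affinePlace_ne_infinityPlace h).symm]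
      simp only [affineDegree]
      ring

theorem pointDivisor_pointPlace_of_notMem {s : Multiset W.Point} {P : W.Point} (hP : P ∉ s) :
    pointDivisor s (W.pointPlace P) = 0 := by
  induction s using Multiset.induction with
  | empty => simp
  | cons Q s ih =>
    rw [Multiset.mem_cons, not_or] at hP
    rw [pointDivisor_cons, Finsupp.add_apply, ih hP.2,
      Finsupp.single_eq_of_ne (pointPlace_injective.ne hP.1), add_zero]

theorem val_le_of_mem_pointIdeal {v : Place F W.FunctionField} (hv : v ≠ W.infinityPlace)
    {P : W.Point} {f : W.CoordinateRing} (hf : f ∈ pointIdeal P) :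
    v.val (algebraMap _ W.FunctionField f) ≤ exp (-Finsupp.single (W.pointPlace P) (1 : ℤ) v) := by
  by_cases hP : v = W.pointPlace P
  · rcases P with _ | ⟨x, y, h⟩
    · exact absurd hP hv
    · have hlt := affinePlace_val_lt_one_of_mem W h hf
      rw [hP, Finsupp.single_eq_same]
      change (affinePlace h).val _ ≤ _
      by_cases h0 : (affinePlace h).val (algebraMap _ W.FunctionField f) = 0
      · rw [h0]
        exact zero_le
      rw [← log_le_iff_le_exp h0]
      rw [← exp_zero, ← log_lt_iff_lt_exp h0] at hlt
      omega
  · rw [Finsupp.single_eq_of_ne hP, neg_zero, exp_zero]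
    exact val_algebraMap_le_one v (val_x_le_one v hv) f

theorem exists_mem_pointIdeal_val_eq {v : Place F W.FunctionField} (hv : v ≠ W.infinityPlace)
    (P : W.Point) : ∃ f ∈ pointIdeal P, v.val (algebraMap _ W.FunctionField f) =
      exp (-Finsupp.single (W.pointPlace P) (1 : ℤ) v) := by
  by_cases hP : v = W.pointPlace P
  · rcases P with _ | ⟨x, y, h⟩
    · exact absurd hP hv
    · obtain ⟨t, ht, hvt⟩ := exists_uniformizer h
      refine ⟨t, ht, ?_⟩
      rw [hP, Finsupp.single_eq_same]
      exact hvt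
  · rw [Finsupp.single_eq_of_ne hP, neg_zero, exp_zero]
    rcases P with _ | ⟨x, y, h⟩
    · exact ⟨1, Submodule.mem_top, by simp⟩
    · by_contra! hne
      refine hP (eq_affinePlace h (val_x_le_one v hv) fun a ha => ?_)
      exact (val_algebraMap_le_one v (val_x_le_one v hv) a).lt_of_ne (hne a ha)

theorem val_le_of_mem_divisorIdeal {v : Place F W.FunctionField} (hv : v ≠ W.infinityPlace)
    {s : Multiset W.Point} {f : W.CoordinateRing} (hf : f ∈ divisorIdeal s) :
    v.val (algebraMap _ W.FunctionField f) ≤ exp (-pointDivisor s v) := by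
  induction s using Multiset.induction generalizing f with
  | empty => simpa using val_algebraMap_le_one v (val_x_le_one v hv) f
  | cons P s ih =>
    rw [divisorIdeal_cons] at hf
    rw [pointDivisor_cons, Finsupp.add_apply, neg_add, exp_add]
    refine Submodule.mul_induction_on hf (fun a ha b hb => ?_) fun a b ha hb => ?_
    · rw [map_mul, map_mul]
      exact mul_le_mul' (val_le_of_mem_pointIdeal hv ha) (ih hb)
    · rw [map_add]
      exact v.val.map_add_le ha hb

/-- The bound of `val_le_of_mem_divisorIdeal` is sharp at each single place. -/
theorem exists_mem_divisorIdeal_val_eq {v : Place F W.FunctionField} (hv : v ≠ W.infinityPlace)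
    (s : Multiset W.Point) : ∃ f ∈ divisorIdeal s, v.val (algebraMap _ W.FunctionField f) =
      exp (-pointDivisor s v) := by
  induction s using Multiset.induction with
  | empty => exact ⟨1, by simp⟩
  | cons P s ih =>
    obtain ⟨f, hf, hvf⟩ := ih
    obtain ⟨g, hg, hvg⟩ := exists_mem_pointIdeal_val_eq hv P
    refine ⟨g * f, ?_, ?_⟩
    · rw [divisorIdeal_cons]
      exact Ideal.mul_mem_mul hg hf
    · rw [map_mul, map_mul, hvf, hvg, pointDivisor_cons, Finsupp.add_apply, neg_add, exp_add]

theorem verticalLine_monic (P : W.Point) : (verticalLine P).Monic := by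
  rcases P with _ | ⟨x, y, h⟩
  · exact monic_one
  · exact monic_X_sub_C x

theorem natDegree_verticalLine (P : W.Point) : (verticalLine P).natDegree = affineDegree P := by
  rcases P with _ | ⟨x, y, h⟩
  · exact natDegree_one
  · exact natDegree_X_sub_C x

theorem verticalLines_ne_zero (s : Multiset W.Point) : verticalLines s ≠ 0 :=
  (monic_multiset_prod_of_monic s _ fun P _ => verticalLine_monic P).ne_zero

theorem natDegree_verticalLines (s : Multiset W.Point) :
    (verticalLines s).natDegree = divisorAffineDegree s := by
  rw [verticalLines, natDegree_multiset_prod_of_monic, Multiset.map_map]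
  · simp [divisorAffineDegree, natDegree_verticalLine]
  · intro p hp
    obtain ⟨P, -, rfl⟩ := Multiset.mem_map.1 hp
    exact verticalLine_monic P

theorem pointIdeal_neg_mul (P : W.Point) : pointIdeal (-P) * pointIdeal P =
    Ideal.span {algebraMap F[X] W.CoordinateRing (verticalLine P)} := by
  rcases P with _ | ⟨x, y, h⟩
  · simp only [verticalLine, map_one, Ideal.span_singleton_one]
    exact Ideal.top_mul _
  · exact CoordinateRing.XYIdeal_neg_mul h

theorem divisorIdeal_neg_mul (s : Multiset W.Point) :
    divisorIdeal (s.map (- ·)) * divisorIdeal s =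
      Ideal.span {algebraMap F[X] W.CoordinateRing (verticalLines s)} := by
  induction s using Multiset.induction with
  | empty => simp [verticalLines]
  | cons P s ih =>
    rw [Multiset.map_cons, divisorIdeal_cons, divisorIdeal_cons, mul_mul_mul_comm, ih,
      pointIdeal_neg_mul, Ideal.span_singleton_mul_span_singleton, ← map_mul]
    simp [verticalLines]

theorem pointIdeal_ne_bot (P : W.Point) : pointIdeal P ≠ ⊥ := by
  intro h
  have := pointIdeal_neg_mul P
  rw [h, Ideal.mul_bot, eq_comm, Ideal.span_singleton_eq_bot] at this
  exact algebraMap_polynomial_ne_zero (verticalLine_monic P).ne_zero this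

theorem divisorIdeal_ne_bot (s : Multiset W.Point) : divisorIdeal s ≠ ⊥ := by
  intro h
  have := divisorIdeal_neg_mul s
  rw [h, Ideal.mul_bot, eq_comm, Ideal.span_singleton_eq_bot] at this
  exact algebraMap_polynomial_ne_zero (verticalLines_ne_zero s) this

/-- A function `g / d`, where `d` is the product of the vertical lines through the points of `s`,
has poles bounded by `s` as soon as `g` vanishes on the negatives of the points of `s` and its pole
order at infinity is at most `2 a + b`, where `a` and `b` are the degrees of the affine part and of
the part at infinity of `s`. -/
theorem div_mem_riemannRochSpace {s : Multiset W.Point} {g : W.CoordinateRing}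
    (hg : g ∈ divisorIdeal (s.map (- ·)))
    (hdeg : (Algebra.norm F[X] g).degree ≤ (divisorAffineDegree s + s.card : ℕ)) :
    algebraMap _ W.FunctionField g /
      algebraMap _ W.FunctionField (algebraMap F[X] W.CoordinateRing (verticalLines s)) ∈
        riemannRochSpace (pointDivisor s) := by
  refine (ord_add_nonneg_iff _ _).2 fun v => ?_
  have hd0 := algebraMap_functionField_ne_zero
    (algebraMap_polynomial_ne_zero (W := W) (verticalLines_ne_zero s))
  rw [map_div₀, div_le_iff₀ (zero_lt_iff.2 ((Valuation.ne_zero_iff _).2 hd0))]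
  by_cases hv : v = W.infinityPlace
  · have hinf := pointDivisor_infinityPlace s
    rw [← infinityValuation_le_exp_iff] at hdeg
    rw [hv]
    change W.infinityValuation _ ≤ _ * W.infinityValuation _
    rw [infinityValuation_polynomial (verticalLines_ne_zero s), natDegree_verticalLines, ← exp_add]
    refine hdeg.trans (exp_le_exp.2 ?_)
    push_cast
    omega
  -- multiply `g` by an `h` of the least possible order along `s`; then `d` divides `g * h`
  · obtain ⟨h, hh, hvh⟩ := exists_mem_divisorIdeal_val_eq hv s
    obtain ⟨r, hr⟩ := Ideal.mem_span_singleton.1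
      ((divisorIdeal_neg_mul s).le (Ideal.mul_mem_mul hg hh))
    have hval := congrArg (fun a => v.val (algebraMap _ W.FunctionField a)) hr
    simp only [map_mul] at hval
    rw [hvh, exp_neg] at hval
    rw [(mul_inv_eq_iff_eq_mul₀ exp_ne_zero).1 hval, mul_comm]
    exact mul_le_mul' le_rfl (mul_le_of_le_one_right zero_le
      (val_algebraMap_le_one v (val_x_le_one v hv) r))

end WeierstrassCurve.Affine

/-! ### A lower bound for the dimension of Riemann-Roch spaces -/

namespace WeierstrassCurve.Affine

variable {F : Type*} [Field F] {W : Affine F}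

variable (W) in
/-- The functions regular away from infinity with pole order at most `m ≥ 1` there form a space of
dimension at least `m`: it contains the `x ^ i` with `2 i ≤ m` and the `x ^ i y` with
`2 i + 3 ≤ m`. -/
theorem exists_submodule_degree_norm_le {m : ℕ} (hm : 0 < m) :
    ∃ V : Submodule F W.CoordinateRing, Module.Finite F V ∧ Module.finrank F V = m ∧
      ∀ f ∈ V, (Algebra.norm F[X] f).degree ≤ m := by
  let φ : degreeLT F (m / 2 + 1) × degreeLT F ((m - 1) / 2) →ₗ[F] W.CoordinateRing :=
    { toFun pq := (pq.1 : F[X]) • 1 + (pq.2 : F[X]) • CoordinateRing.mk W Y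
      map_add' a b := by
        simp only [Prod.fst_add, Prod.snd_add, Submodule.coe_add, add_smul]
        abel
      map_smul' c a := by
        simp only [Prod.smul_fst, Prod.smul_snd, Submodule.coe_smul, smul_assoc, smul_add,
          RingHom.id_apply] }
  have hφ : Function.Injective φ := by
    refine (injective_iff_map_eq_zero φ).2 fun pq h => ?_
    obtain ⟨h1, h2⟩ := CoordinateRing.smul_basis_eq_zero h
    exact Prod.ext (Subtype.ext h1) (Subtype.ext h2)
  have hfin (n : ℕ) : Module.Finite F (degreeLT F n) := .equiv (degreeLTEquiv F n).symm
  refine ⟨LinearMap.range φ, inferInstance, ?_, ?_⟩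
  · rw [LinearMap.finrank_range_of_inj hφ, Module.finrank_prod, (degreeLTEquiv F _).finrank_eq,
      (degreeLTEquiv F _).finrank_eq, Module.finrank_fin_fun, Module.finrank_fin_fun]
    omega
  · rintro _ ⟨⟨⟨p, hp⟩, ⟨q, hq⟩⟩, rfl⟩
    rw [mem_degreeLT] at hp hq
    change (Algebra.norm F[X] (p • (1 : W.CoordinateRing) + q • CoordinateRing.mk W Y)).degree ≤ m
    rw [CoordinateRing.degree_norm_smul_basis, max_le_iff]
    constructor
    · by_cases h0 : p = 0
      · rw [h0, degree_zero, two_nsmul, WithBot.bot_add]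
        exact bot_le
      · rw [degree_eq_natDegree h0, nsmul_eq_mul] at *
        norm_cast at *
        omega
    · by_cases h0 : q = 0
      · rw [h0, degree_zero, two_nsmul, WithBot.bot_add, WithBot.bot_add]
        exact bot_le
      · rw [degree_eq_natDegree h0, nsmul_eq_mul] at *
        norm_cast at *
        omega

/-- Multiplying an ideal `I` by the ideal of a point imposes at most one linear condition: there is
no ideal strictly between the two, so any `c` in `I` outside the product generates `I` modulo the
product. -/
theorem finrank_inf_le [W.IsElliptic] (V : Submodule F W.CoordinateRing) [Module.Finite F V]
    (P : W.Point) {I : Ideal W.CoordinateRing} (hI : I ≠ ⊥) :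
    Module.finrank F (V ⊓ I.restrictScalars F : Submodule F W.CoordinateRing) ≤
      Module.finrank F (V ⊓ (pointIdeal P * I).restrictScalars F : Submodule F W.CoordinateRing) +
        affineDegree P := by
  rcases P with _ | ⟨x, y, h⟩
  · have : pointIdeal (W := W) .zero * I = I := Ideal.top_mul I
    rw [this]
    exact Nat.le_add_right _ _
  set J := pointIdeal (.some x y h) * I with hJ
  have hVI : Module.Finite F (V ⊓ I.restrictScalars F : Submodule F W.CoordinateRing) :=
    Submodule.finiteDimensional_of_le inf_le_left
  have hVJ : Module.Finite F (V ⊓ J.restrictScalars F : Submodule F W.CoordinateRing) :=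
    Submodule.finiteDimensional_of_le inf_le_left
  by_cases hle : V ⊓ I.restrictScalars F ≤ V ⊓ J.restrictScalars F
  · exact (Submodule.finrank_mono hle).trans (Nat.le_add_right _ _)
  obtain ⟨c, ⟨hcV, hcI⟩, hcJ⟩ := SetLike.not_le_iff_exists.1 hle
  replace hcJ : c ∉ J := fun hc => hcJ ⟨hcV, hc⟩
  have hspan : Ideal.span {c} ⊔ J = I := by
    have hle : Ideal.span {c} ⊔ J ≤ I :=
      sup_le ((Ideal.span_singleton_le_iff_mem _).2 hcI) Ideal.mul_le_right
    obtain ⟨A, hA⟩ := Ideal.dvd_iff_le.2 hle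
    have hPA : CoordinateRing.XYIdeal W x (C y) ≤ A := by
      have : I * pointIdeal (.some x y h) ≤ I * A := by
        rw [← hA, mul_comm]
        exact le_sup_right
      exact Ideal.dvd_iff_le.1 ((mul_dvd_mul_iff_left hI).1 (Ideal.dvd_iff_le.2 this))
    by_cases hA' : A = ⊤
    · rw [hA, hA', Ideal.mul_top]
    · rw [← (xyIdeal_isMaximal h).eq_of_le hA' hPA, mul_comm] at hA
      refine absurd ?_ hcJ
      exact hA.le (Ideal.mem_sup_left (Ideal.mem_span_singleton_self c))
  have hsup : V ⊓ I.restrictScalars F ≤ (V ⊓ J.restrictScalars F) ⊔ Submodule.span F {c} := by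
    rintro f ⟨hfV, hfI⟩
    have hfI' : f ∈ Ideal.span {c} ⊔ J := hspan ▸ hfI
    obtain ⟨_, ha, b, hb, rfl⟩ := Submodule.mem_sup.1 hfI'
    obtain ⟨r, rfl⟩ := Ideal.mem_span_singleton'.1 ha
    obtain ⟨t, ht⟩ := exists_sub_algebraMap_mem h r
    have hmem : r * c + b - t • c ∈ V ⊓ J.restrictScalars F := by
      refine ⟨sub_mem hfV (V.smul_mem t hcV), ?_⟩
      change r * c + b - t • c ∈ J
      rw [Algebra.smul_def, show r * c + b - algebraMap F _ t * c =
        (r - algebraMap F _ t) * c + b by ring]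
      exact add_mem (Ideal.mul_mem_mul ht hcI) hb
    rw [← sub_add_cancel (r * c + b) (t • c)]
    exact Submodule.add_mem_sup hmem (Submodule.smul_mem _ t (Submodule.mem_span_singleton_self c))
  refine (Submodule.finrank_mono hsup).trans
    ((Submodule.finrank_add_le_finrank_add_finrank _ _).trans ?_)
  have hc0 : c ≠ 0 := by
    rintro rfl
    exact hcJ (zero_mem _)
  rw [finrank_span_singleton hc0]
  exact le_rfl

theorem finrank_le_finrank_inf_divisorIdeal [W.IsElliptic] (V : Submodule F W.CoordinateRing)
    [Module.Finite F V] (s : Multiset W.Point) : Module.finrank F V ≤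
      Module.finrank F (V ⊓ (divisorIdeal s).restrictScalars F : Submodule F W.CoordinateRing) +
        divisorAffineDegree s := by
  induction s using Multiset.induction with
  | empty =>
    rw [divisorIdeal_zero, Submodule.restrictScalars_top, inf_top_eq]
    exact Nat.le_add_right _ _
  | cons P s ih =>
    rw [divisorIdeal_cons, divisorAffineDegree_cons]
    have := finrank_inf_le V P (divisorIdeal_ne_bot s)
    omega

/-- The inequality `dim L(G) ≥ deg G` for a nonzero effective sum `G` of rational points. -/
theorem exists_submodule_le_riemannRochSpace [W.IsElliptic] {s : Multiset W.Point}
    (hs : 0 < s.card) :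
    ∃ V ≤ riemannRochSpace (pointDivisor s), Module.Finite F V ∧ s.card ≤ Module.finrank F V := by
  obtain ⟨V, hVfin, hVrank, hV⟩ :=
    exists_submodule_degree_norm_le W (show 0 < divisorAffineDegree s + s.card by omega)
  set U := V ⊓ (divisorIdeal (s.map (- ·))).restrictScalars F with hU
  have hUfin : Module.Finite F U := Submodule.finiteDimensional_of_le inf_le_left
  set d := algebraMap _ W.FunctionField (algebraMap F[X] W.CoordinateRing (verticalLines s)) with hd
  have hd0 : d ≠ 0 := algebraMap_functionField_ne_zero
    (algebraMap_polynomial_ne_zero (W := W) (verticalLines_ne_zero s))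
  let φ : W.CoordinateRing →ₗ[F] W.FunctionField :=
    LinearMap.mulRight F d⁻¹ ∘ₗ
      (IsScalarTower.toAlgHom F W.CoordinateRing W.FunctionField).toLinearMap
  have hφ : Function.Injective φ := by
    intro a b hab
    exact IsFractionRing.injective W.CoordinateRing W.FunctionField
      (mul_left_injective₀ (inv_ne_zero hd0) hab)
  refine ⟨U.map φ, ?_, inferInstance, ?_⟩
  · rintro _ ⟨g, ⟨hgV, hgI⟩, rfl⟩
    exact div_mem_riemannRochSpace hgI (hV g hgV)
  · rw [← (Submodule.equivMapOfInjective φ hφ U).finrank_eq]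
    have := finrank_le_finrank_inf_divisorIdeal V (s.map (- ·))
    rw [divisorAffineDegree_map_neg, ← hU] at this
    omega

end WeierstrassCurve.Affine

/-! ### The divisor of a function and the group law -/

namespace WeierstrassCurve.Affine

variable {F : Type*} [Field F] {W : Affine F}

theorem natDegree_norm_algebraMap (p : F[X]) :
    (Algebra.norm F[X] (algebraMap F[X] W.CoordinateRing p)).natDegree = 2 * p.natDegree := by
  rw [Algebra.norm_algebraMap_of_basis (CoordinateRing.basis W), natDegree_pow, Fintype.card_fin]

section IdealDegree

variable [W.IsElliptic]

/-- The degree of an ideal of the coordinate ring: the degree of a polynomial generating its norm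
down to `F[X]`. -/
noncomputable def idealDegree (I : Ideal W.CoordinateRing) : ℕ :=
  (Submodule.IsPrincipal.generator (Ideal.relNorm F[X] I)).natDegree

theorem idealDegree_eq_of_relNorm {I : Ideal W.CoordinateRing} {p : F[X]}
    (h : Ideal.relNorm F[X] I = Ideal.span {p}) : idealDegree I = p.natDegree := by
  have hassoc : Associated (Submodule.IsPrincipal.generator (Ideal.relNorm F[X] I)) p := by
    rw [← Ideal.span_singleton_eq_span_singleton, Ideal.span_singleton_generator, h]
  exact natDegree_eq_of_degree_eq (degree_eq_degree_of_associated hassoc)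

theorem idealDegree_span_singleton (a : W.CoordinateRing) :
    idealDegree (Ideal.span {a}) = (Algebra.norm F[X] a).natDegree := by
  refine idealDegree_eq_of_relNorm ?_
  rw [Ideal.relNorm_singleton, Algebra.intNorm_eq_norm]

theorem idealDegree_mul {I J : Ideal W.CoordinateRing} (hI : I ≠ ⊥) (hJ : J ≠ ⊥) :
    idealDegree (I * J) = idealDegree I + idealDegree J := by
  change _ = natDegree _ + natDegree _
  rw [← natDegree_mul]
  · refine idealDegree_eq_of_relNorm ?_
    rw [map_mul, ← Ideal.span_singleton_mul_span_singleton, Ideal.span_singleton_generator,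
      Ideal.span_singleton_generator]
  · rwa [Ne, ← Submodule.IsPrincipal.eq_bot_iff_generator_eq_zero, Ideal.relNorm_eq_bot_iff]
  · rwa [Ne, ← Submodule.IsPrincipal.eq_bot_iff_generator_eq_zero, Ideal.relNorm_eq_bot_iff]

theorem idealDegree_top : idealDegree (⊤ : Ideal W.CoordinateRing) = 0 := by
  rw [← Ideal.span_singleton_one, idealDegree_span_singleton, map_one, natDegree_one]

theorem eq_top_of_idealDegree_eq_zero {I : Ideal W.CoordinateRing} (hI : I ≠ ⊥)
    (h : idealDegree I = 0) : I = ⊤ := by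
  have hne : Submodule.IsPrincipal.generator (Ideal.relNorm F[X] I) ≠ 0 := by
    rwa [Ne, ← Submodule.IsPrincipal.eq_bot_iff_generator_eq_zero, Ideal.relNorm_eq_bot_iff]
  have htop : Ideal.relNorm F[X] I = ⊤ := by
    rw [← Ideal.span_singleton_generator (Ideal.relNorm F[X] I), Ideal.span_singleton_eq_top,
      eq_C_of_natDegree_eq_zero h]
    rw [eq_C_of_natDegree_eq_zero h] at hne
    exact isUnit_C.2 (isUnit_iff_ne_zero.2 fun h0 => hne (by rw [h0, map_zero]))
  have := Ideal.relNorm_le_comap F[X] I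
  rw [htop, top_le_iff, Ideal.comap_eq_top_iff] at this
  exact this

theorem idealDegree_pointIdeal (P : W.Point) : idealDegree (pointIdeal P) = affineDegree P := by
  rcases P with _ | ⟨x, y, h⟩
  · exact idealDegree_top
  -- the ideals of `P` and `-P` are proper and the degree of their product is two
  · have hpos (Q : W.Point) (hQ : pointIdeal Q ≠ ⊤) : 0 < idealDegree (pointIdeal Q) :=
      Nat.pos_of_ne_zero fun h0 => hQ (eq_top_of_idealDegree_eq_zero (pointIdeal_ne_bot Q) h0)
    have h1 := hpos (.some x y h) (xyIdeal_isMaximal h).ne_top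
    have h2 := hpos (-(Point.some x y h : W.Point))
      (xyIdeal_isMaximal ((nonsingular_neg ..).2 h)).ne_top
    have h3 := congrArg idealDegree (pointIdeal_neg_mul (.some x y h))
    rw [idealDegree_mul (pointIdeal_ne_bot _) (pointIdeal_ne_bot _), idealDegree_span_singleton,
      natDegree_norm_algebraMap, natDegree_verticalLine] at h3
    simp only [affineDegree] at h3 ⊢
    omega

theorem idealDegree_divisorIdeal (s : Multiset W.Point) :
    idealDegree (divisorIdeal s) = divisorAffineDegree s := by
  induction s using Multiset.induction with
  | empty => simp [idealDegree_top]
  | cons P s ih =>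
    rw [divisorIdeal_cons, divisorAffineDegree_cons,
      idealDegree_mul (pointIdeal_ne_bot P) (divisorIdeal_ne_bot s), ih, idealDegree_pointIdeal]

end IdealDegree

/-- A maximal ideal of the coordinate ring defines a place. -/
noncomputable def primePlace [W.IsElliptic]
    (p : IsDedekindDomain.HeightOneSpectrum W.CoordinateRing) : Place F W.FunctionField where
  val := p.valuation W.FunctionField
  surjective := p.valuation_surjective _
  trivial_on_constants c hc := by
    rw [IsScalarTower.algebraMap_apply F W.CoordinateRing W.FunctionField,
      IsDedekindDomain.HeightOneSpectrum.valuation_eq_one_iff_notMem]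
    exact fun h => p.isPrime.ne_top
      (Ideal.eq_top_of_isUnit_mem _ h ((IsUnit.mk0 c hc).map (algebraMap F W.CoordinateRing)))

theorem primePlace_ne_infinityPlace [W.IsElliptic]
    (p : IsDedekindDomain.HeightOneSpectrum W.CoordinateRing) : primePlace p ≠ W.infinityPlace := by
  intro heq
  have h1 : (primePlace p).val W.xFun ≤ 1 := p.valuation_le_one _
  have h2 : W.infinityPlace.val W.xFun = exp (2 : ℤ) := W.infinityValuation_x
  rw [heq, h2, ← exp_zero, exp_le_exp] at h1
  norm_num at h1

/-- A function without poles outside infinity lies in the coordinate ring, which is integrally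
closed. -/
theorem exists_algebraMap_eq [W.IsElliptic] {f : W.FunctionField}
    (hf : ∀ v : Place F W.FunctionField, v ≠ W.infinityPlace → v.val f ≤ 1) :
    ∃ r : W.CoordinateRing, algebraMap _ W.FunctionField r = f :=
  IsDedekindDomain.HeightOneSpectrum.mem_integers_of_valuation_le_one W.FunctionField f fun p =>
    hf (primePlace p) (primePlace_ne_infinityPlace p)

theorem mem_pointIdeal_of_val_lt_one {P : W.Point} {f : W.CoordinateRing}
    (hf : (W.pointPlace P).val (algebraMap _ W.FunctionField f) < 1) : f ∈ pointIdeal P := by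
  rcases P with _ | ⟨x, y, h⟩
  · exact Submodule.mem_top
  · by_contra hmem
    exact hf.ne (affinePlace_val_eq_one h hmem)

theorem isCoprime_pointIdeal {P Q : W.Point} (hPQ : P ≠ Q) :
    IsCoprime (pointIdeal P) (pointIdeal Q) := by
  rw [Ideal.isCoprime_iff_sup_eq]
  rcases P with _ | ⟨x, y, h⟩
  · exact top_sup_eq _
  rcases Q with _ | ⟨x', y', h'⟩
  · exact sup_top_eq _
  refine Ideal.IsMaximal.coprime_of_ne (xyIdeal_isMaximal h) (xyIdeal_isMaximal h')
    fun heq => hPQ ?_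
  refine pointPlace_injective (?_ : affinePlace h = affinePlace h')
  refine eq_affinePlace h' (val_x_le_one _ (affinePlace_ne_infinityPlace h)) fun a ha => ?_
  exact affinePlace_val_lt_one_of_mem W h (heq.ge ha)

theorem mem_divisorIdeal_of_forall_mem [W.IsElliptic] {T : Finset W.Point} {f : W.CoordinateRing}
    (hf : ∀ P ∈ T, f ∈ pointIdeal P) : f ∈ divisorIdeal T.val := by
  rw [← Ideal.span_singleton_le_iff_mem]
  exact Ideal.le_of_dvd (Finset.prod_dvd_of_coprime (fun P _ Q _ hPQ => isCoprime_pointIdeal hPQ)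
    fun P hP => Ideal.dvd_span_singleton.2 (hf P hP))

variable [DecidableEq F]

/-- The sum of points in the group law is the class of the corresponding product of ideals. -/
theorem exists_toClass_sum_eq (s : Multiset W.Point) :
    ∃ U : (FractionalIdeal W.CoordinateRing⁰ W.FunctionField)ˣ,
      (U : FractionalIdeal W.CoordinateRing⁰ W.FunctionField) = divisorIdeal s ∧
      Point.toClass s.sum = Additive.ofMul (ClassGroup.mk W.FunctionField U) := by
  induction s using Multiset.induction with
  | empty => exact ⟨1, by simp, by simp⟩
  | cons P s ih =>
    obtain ⟨U, hU, hUs⟩ := ih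
    obtain ⟨V, hV, hVP⟩ : ∃ V : (FractionalIdeal W.CoordinateRing⁰ W.FunctionField)ˣ,
        (V : FractionalIdeal W.CoordinateRing⁰ W.FunctionField) = pointIdeal P ∧
        Point.toClass P = Additive.ofMul (ClassGroup.mk W.FunctionField V) := by
      rcases P with _ | ⟨x, y, h⟩
      · refine ⟨1, ?_, ?_⟩
        · rw [pointIdeal, FractionalIdeal.coeIdeal_top, Units.val_one]
        · rw [map_one, ofMul_one]
          exact Point.toClass_zero
      · exact ⟨CoordinateRing.XYIdeal' (W := W) h, rfl, Point.toClass_some h⟩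
    refine ⟨V * U, ?_, ?_⟩
    · rw [Units.val_mul, hU, hV, divisorIdeal_cons, FractionalIdeal.coeIdeal_mul]
    · rw [Multiset.sum_cons, map_add, hUs, hVP, map_mul, ofMul_mul]

theorem sum_eq_sum_of_span_mul_divisorIdeal_eq {s t : Multiset W.Point} {a b : W.CoordinateRing}
    (ha : a ≠ 0) (hb : b ≠ 0)
    (h : Ideal.span {a} * divisorIdeal s = Ideal.span {b} * divisorIdeal t) : s.sum = t.sum := by
  obtain ⟨U, hU, hs⟩ := exists_toClass_sum_eq s
  obtain ⟨V, hV, ht⟩ := exists_toClass_sum_eq t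
  refine Point.toClass_injective ?_
  rw [hs, ht, (ClassGroup.mk_eq_mk_of_coe_ideal hU hV).2 ⟨a, b, ha, hb, h⟩]

/-- **Abel's theorem** in the form needed for codes: a function with poles bounded by `s` that
vanishes on a set `T` of as many points, disjoint from `s`, has divisor exactly `T - s`, so that the
two sums of points agree in the group law. -/
theorem sum_eq_sum_of_vanishing [W.IsElliptic] {s : Multiset W.Point} {T : Finset W.Point}
    (hcard : T.card = s.card) (hdisj : ∀ P ∈ T, P ∉ s) {f : W.FunctionField} (hf0 : f ≠ 0)
    (hf : f ∈ riemannRochSpace (pointDivisor s)) (hT : ∀ P ∈ T, (W.pointPlace P).val f < 1) :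
    T.val.sum = s.sum := by
  classical
  replace hf := (ord_add_nonneg_iff _ _).1 hf
  have hmem {h : W.CoordinateRing} (hh : h ∈ divisorIdeal s) : ∃ r ∈ divisorIdeal T.val,
      algebraMap _ W.FunctionField r = f * algebraMap _ W.FunctionField h := by
    obtain ⟨r, hr⟩ := exists_algebraMap_eq (f := f * algebraMap _ W.FunctionField h) fun v hv => by
      rw [map_mul]
      refine (mul_le_mul' (hf v) (val_le_of_mem_divisorIdeal hv hh)).trans ?_
      rw [← exp_add, add_neg_cancel, exp_zero]
    refine ⟨r, mem_divisorIdeal_of_forall_mem fun P hP => ?_, hr⟩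
    by_cases hP0 : P = 0
    · subst hP0
      exact Submodule.mem_top
    · refine mem_pointIdeal_of_val_lt_one ?_
      rw [hr, map_mul]
      refine mul_lt_one_of_lt_of_le (hT P hP) (val_algebraMap_le_one _ (val_x_le_one _ ?_) _)
      exact pointPlace_injective.ne hP0
  obtain ⟨g, d, hd, rfl⟩ := exists_eq_div_polynomial f
  have hd0 := algebraMap_polynomial_ne_zero (W := W) hd
  have hdK := algebraMap_functionField_ne_zero hd0
  have hg0 : g ≠ 0 := by
    rintro rfl
    simp at hf0
  set D := algebraMap F[X] W.CoordinateRing d with hD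
  have hle : Ideal.span {g} * divisorIdeal s ≤ Ideal.span {D} * divisorIdeal T.val := by
    refine Ideal.span_singleton_mul_le_iff.2 fun h hh => ?_
    obtain ⟨r, hr, hrf⟩ := hmem hh
    refine Ideal.mem_span_singleton_mul.2 ⟨r, hr,
      IsFractionRing.injective W.CoordinateRing W.FunctionField ?_⟩
    rw [map_mul, map_mul, hrf]
    field_simp
  obtain ⟨A, hA⟩ := Ideal.dvd_iff_le.2 hle
  have hspan {a : W.CoordinateRing} (ha : a ≠ 0) : Ideal.span {a} ≠ ⊥ := by
    rwa [Ne, Ideal.span_singleton_eq_bot]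
  have hgs : Ideal.span {g} * divisorIdeal s ≠ ⊥ :=
    mul_ne_zero (hspan hg0) (divisorIdeal_ne_bot s)
  have hDT : Ideal.span {D} * divisorIdeal T.val ≠ ⊥ :=
    mul_ne_zero (hspan hd0) (divisorIdeal_ne_bot _)
  have hA0 : A ≠ ⊥ := by
    rintro rfl
    rw [Ideal.mul_bot] at hA
    exact hgs hA
  have hdegs := congrArg idealDegree hA
  rw [idealDegree_mul hDT hA0, idealDegree_mul (hspan hg0) (divisorIdeal_ne_bot s),
    idealDegree_mul (hspan hd0) (divisorIdeal_ne_bot _), idealDegree_divisorIdeal,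
    idealDegree_divisorIdeal, idealDegree_span_singleton, idealDegree_span_singleton] at hdegs
  have hval : W.infinityPlace.val
      (algebraMap _ W.FunctionField g / algebraMap _ W.FunctionField D) =
      exp ((Algebra.norm F[X] g).natDegree - (Algebra.norm F[X] D).natDegree : ℤ) := by
    change W.infinityValuation _ = _
    rw [map_div₀, infinityValuation_apply, infinityValuation_apply,
      infinityValuationAux_apply W hg0, infinityValuationAux_apply W hd0, ← exp_sub]
  have hs := pointDivisor_infinityPlace s
  have ht := pointDivisor_infinityPlace T.val
  rw [Finset.card_val, hcard] at ht
  -- `deg (g / D)` is bounded by the order of `f` at infinity, where `f` has a zero if `0 ∈ T`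
  have hA1 : idealDegree A = 0 := by
    by_cases h0 : (0 : W.Point) ∈ T
    · have h1 : (W.infinityPlace).val _ < 1 := hT 0 h0
      rw [hval, ← exp_zero, exp_lt_exp] at h1
      have h2 : pointDivisor s W.infinityPlace = 0 :=
        pointDivisor_pointPlace_of_notMem (hdisj 0 h0)
      have h3 : pointDivisor T.val W.infinityPlace = 1 := by
        have hnot : (0 : W.Point) ∉ (T.erase 0).val := Finset.notMem_erase 0 T
        rw [← Finset.insert_erase h0, Finset.insert_val_of_notMem (Finset.notMem_erase 0 T),
          pointDivisor_cons, Finsupp.add_apply]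
        have h4 : pointDivisor (T.erase 0).val W.infinityPlace = 0 :=
          pointDivisor_pointPlace_of_notMem hnot
        rw [h4, add_zero]
        exact Finsupp.single_eq_same
      omega
    · have h1 := hf W.infinityPlace
      rw [hval, exp_le_exp] at h1
      have h2 : pointDivisor T.val W.infinityPlace = 0 :=
        pointDivisor_pointPlace_of_notMem h0
      omega
  rw [eq_top_of_idealDegree_eq_zero hA0 hA1, Ideal.mul_top] at hA
  exact (sum_eq_sum_of_span_mul_divisorIdeal_eq hg0 hd0 hA).symm

end WeierstrassCurve.Affine

/-! ### Codes from divisors of points -/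

section Codes

variable {F : Type*} [Field F] {n : ℕ}

open scoped Classical in
/-- The argument of the Singleton bound: more than `m` dimensions leave room for a nonzero codeword
vanishing in the first `m` coordinates. -/
theorem exists_hammingNorm_le (C : Submodule F (Fin n → F)) {m : ℕ} (hm : m ≤ n)
    (hC : m < Module.finrank F C) : ∃ c ∈ C, c ≠ 0 ∧ hammingNorm c ≤ n - m := by
  let π : C →ₗ[F] (Fin m → F) := LinearMap.funLeft F F (Fin.castLE hm) ∘ₗ C.subtype
  obtain ⟨c, hc, hc0⟩ := Submodule.exists_mem_ne_zero_of_ne_bot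
    (LinearMap.ker_ne_bot_of_finrank_lt (f := π) (by simpa using hC))
  have hzero (i : Fin m) : (c : Fin n → F) (Fin.castLE hm i) = 0 := congrFun hc i
  refine ⟨c, c.2, fun h => hc0 (Subtype.ext h), ?_⟩
  calc hammingNorm (c : Fin n → F) ≤ ((Finset.univ.map (Fin.castLEEmb hm))ᶜ).card := by
        refine Finset.card_le_card fun i hi => ?_
        rw [Finset.mem_compl, Finset.mem_map]
        rintro ⟨j, -, rfl⟩
        exact (Finset.mem_filter.1 hi).2 (hzero j)
    _ = n - m := by
        rw [Finset.card_compl, Finset.card_map, Finset.card_univ, Fintype.card_fin,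
          Fintype.card_fin]

/-- A code of dimension at least `k` in which every set of `k` coordinates determines the codeword
is an `[n, k, n - k + 1]` code. -/
theorem isLinearCode_of_forall_eq_zero {C : Submodule F (Fin n → F)} {k : ℕ} (hk : 0 < k)
    (hkn : k ≤ n) (hC : ∀ c ∈ C, ∀ S : Finset (Fin n), S.card = k → (∀ i ∈ S, c i = 0) → c = 0)
    (hdim : k ≤ Module.finrank F C) : IsLinearCode C n k (n - k + 1) := by
  classical
  have hlow (c) (hc : c ∈ C) (hc0 : c ≠ 0) : n - k + 1 ≤ hammingNorm c := by
    by_contra! hlt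
    have hcard : (Finset.univ.filter fun i => c i = 0).card + hammingNorm c = n := by
      rw [hammingNorm, Finset.card_filter_add_card_filter_not, Finset.card_univ, Fintype.card_fin]
    obtain ⟨S, hS, hSk⟩ := Finset.exists_subset_card_eq
      (show k ≤ (Finset.univ.filter fun i => c i = 0).card by omega)
    exact hc0 (hC c hc S hSk fun i hi => (Finset.mem_filter.1 (hS hi)).2)
  have hrank : Module.finrank F C = k := by
    refine le_antisymm (le_of_not_gt fun hlt => ?_) hdim
    obtain ⟨c, hc, hc0, hle⟩ := exists_hammingNorm_le C hkn hlt
    have := hlow c hc hc0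
    have : hammingNorm c ≤ n - k := by convert hle
    omega
  refine ⟨Fintype.card_fin n, hrank, ?_, ?_⟩
  · obtain ⟨c, hc, hc0, hle⟩ := exists_hammingNorm_le C (show k - 1 ≤ n by omega)
      (show k - 1 < Module.finrank F C by omega)
    refine ⟨c, hc, hc0, ?_⟩
    have := hlow c hc hc0
    have h2 : hammingNorm c ≤ n - (k - 1) := by convert hle
    convert (show hammingNorm c = n - k + 1 by omega)
  · rintro _ ⟨c, hc, hc0, rfl⟩
    convert hlow c hc hc0

theorem IsLinearCode.isMDS {ι : Type*} [Fintype ι] {C : Submodule F (ι → F)} {n k d : ℕ}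
    (h : IsLinearCode C n k d) (hd : d + k = n + 1) : IsMDS C := ⟨n, k, d, h, hd⟩

end Codes

/-- Doubling is not injective, hence not surjective, so the group modulo its doubles is a nonzero
vector space over `ZMod 2` and has a nonzero linear form. -/
theorem exists_addSubgroup_index_eq_two {A : Type*} [AddCommGroup A] [Finite A]
    (hA : Even (Nat.card A)) : ∃ H : AddSubgroup A, H.index = 2 := by
  let φ : A →+ A := nsmulAddMonoidHom 2
  have hφ : φ.range ≠ ⊤ := by
    intro htop
    have hinj : Function.Injective φ :=
      Finite.injective_iff_surjective.2 (AddMonoidHom.range_eq_top.1 htop)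
    obtain ⟨a, ha⟩ := exists_prime_addOrderOf_dvd_card' 2 hA.two_dvd
    have h0 : a = 0 := hinj (by
      rw [map_zero]
      change 2 • a = 0
      rw [← ha, addOrderOf_nsmul_eq_zero])
    rw [h0, addOrderOf_zero] at ha
    norm_num at ha
  let : Module (ZMod 2) (A ⧸ φ.range) := AddCommGroup.zmodModule (n := 2) fun x => by
    obtain ⟨a, rfl⟩ := QuotientAddGroup.mk_surjective x
    rw [← QuotientAddGroup.mk_nsmul, QuotientAddGroup.eq_zero_iff]
    exact ⟨a, rfl⟩
  have hnt : Nontrivial (A ⧸ φ.range) := QuotientAddGroup.nontrivial_iff.2 hφ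
  obtain ⟨x, hx⟩ := exists_ne (0 : A ⧸ φ.range)
  obtain ⟨f, hf⟩ : ∃ f : Module.Dual (ZMod 2) (A ⧸ φ.range), f x ≠ 0 := by
    by_contra! h
    exact hx ((Module.forall_dual_apply_eq_zero_iff (ZMod 2) x).1 h)
  have hsurj : Function.Surjective f :=
    LinearMap.surjective_of_ne_zero fun h0 => hf (by rw [h0]; rfl)
  let ψ : A →+ ZMod 2 := f.toAddMonoidHom.comp (QuotientAddGroup.mk' φ.range)
  have hψ : Function.Surjective ψ := hsurj.comp (QuotientAddGroup.mk'_surjective _)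
  refine ⟨ψ.ker, ?_⟩
  rw [AddSubgroup.index_ker, AddMonoidHom.range_eq_top.2 hψ, AddSubgroup.card_top, Nat.card_zmod]

namespace WeierstrassCurve.Affine

variable {F : Type*} [Field F] {W : Affine F}

instance [Finite F] : Finite W.Point := by
  have : Finite (WithZero {xy : F × F // W.Nonsingular xy.1 xy.2}) :=
    inferInstanceAs (Finite (Option _))
  exact .of_equiv _ (nonsingularPointEquiv W).symm

theorem pointDivisor_replicate (k : ℕ) (P : W.Point) :
    pointDivisor (Multiset.replicate k P) = Finsupp.single (W.pointPlace P) (k : ℤ) := by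
  simp [pointDivisor]

variable [DecidableEq F] [W.IsElliptic]

/-- If no set of evaluation points has the same sum as `s`, then no nonzero function with
poles bounded by `s` vanishes at `s.card` evaluation points, and the code is MDS. -/
theorem isLinearCode_agCode {s : Multiset W.Point} (hs : 0 < s.card) {n : ℕ} (hn : s.card ≤ n)
    {D : Fin n → W.Point} (hD : Function.Injective D) (hdisj : ∀ i, D i ∉ s)
    (hsum : ∀ T : Finset (Fin n), ∑ i ∈ T, D i ≠ s.sum) :
    IsLinearCode (agCode (fun i => W.pointPlace (D i)) (pointDivisor s)) n s.card
      (n - s.card + 1) := by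
  have hvanish {f : W.FunctionField} (hf : f ∈ riemannRochSpace (pointDivisor s))
      {S : Finset (Fin n)} (hS : S.card = s.card)
      (hfS : ∀ i ∈ S, (W.pointPlace (D i)).val f < 1) : f = 0 := by
    by_contra hf0
    refine hsum S ?_
    have := sum_eq_sum_of_vanishing (T := S.map ⟨D, hD⟩)
      (by rw [Finset.card_map, hS]) ?_ hf0 hf ?_
    · rw [← this, Finset.map_val, Finset.sum]
      rfl
    · simpa using fun i _ => hdisj i
    · simpa using hfS
  have hval (f : riemannRochSpace (pointDivisor s)) (i : Fin n) :
      ∃ c, (W.pointPlace (D i)).HasValue (f : W.FunctionField) c := by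
    refine exists_hasValue_pointPlace _ ?_
    have := (ord_add_nonneg_iff _ _).1 f.2 (W.pointPlace (D i))
    rwa [pointDivisor_pointPlace_of_notMem (hdisj i), exp_zero] at this
  choose c hc using hval
  let ev : riemannRochSpace (pointDivisor s) →ₗ[F]
      agCode (fun i => W.pointPlace (D i)) (pointDivisor s) :=
    { toFun f := ⟨c f, f, f.2, hc f⟩
      map_add' f g := by
        refine Subtype.ext (funext fun i => (hc (f + g) i).unique ?_)
        have := (W.pointPlace (D i)).val.map_add_lt (hc f i) (hc g i)
        rwa [sub_add_sub_comm, ← map_add] at this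
      map_smul' a f := by
        refine Subtype.ext (funext fun i => (hc (a • f) i).unique ?_)
        have := (mul_le_of_le_one_left' ((W.pointPlace (D i)).val_constant_le_one a)).trans_lt
          (hc f i)
        rw [← map_mul, mul_sub, ← map_mul, ← Algebra.smul_def] at this
        exact this }
  have hev : Function.Injective ev := by
    refine (injective_iff_map_eq_zero ev).2 fun f hf => Subtype.ext ?_
    obtain ⟨S, -, hS⟩ := Finset.exists_subset_card_eq
      (show s.card ≤ (Finset.univ : Finset (Fin n)).card by
        rwa [Finset.card_univ, Fintype.card_fin])
    refine hvanish f.2 hS fun i _ => ?_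
    have h0 : c f i = 0 := congrFun (congrArg Subtype.val hf) i
    have := hc f i
    rwa [h0, Place.HasValue, map_zero, sub_zero] at this
  refine isLinearCode_of_forall_eq_zero hs hn ?_ ?_
  · rintro a ⟨f, hf, hfa⟩ S hS haS
    have hf0 : f = 0 := hvanish hf hS fun i hi => by
      have := hfa i
      rwa [haS i hi, Place.HasValue, map_zero, sub_zero] at this
    funext i
    refine (hfa i).unique ?_
    rw [hf0, Place.HasValue]
    simp
  · obtain ⟨V, hV, hVfin, hVrank⟩ := exists_submodule_le_riemannRochSpace hs
    exact hVrank.trans (LinearMap.finrank_le_finrank_of_injective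
      (f := ev ∘ₗ Submodule.inclusion hV) (hev.comp (Submodule.inclusion_injective hV)))

end WeierstrassCurve.Affine

/-! ### Codes from a subgroup of index two -/

theorem theorem1 {F : Type*} [Field F] [Finite F] [DecidableEq F]
    (W : WeierstrassCurve F) [W.IsElliptic] (hN : Even (Nat.card W.toAffine.Point)) :
    (∃ H : AddSubgroup W.toAffine.Point, H.index = 2) ∧
    ∀ H : AddSubgroup W.toAffine.Point, H.index = 2 →
      (∃ Q : W.toAffine.Point, Q ∉ H) ∧
      (∀ Q : W.toAffine.Point, Q ∉ H →
        ∀ (n : ℕ) (D : Fin n → W.toAffine.Point), Function.Injective D →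
          Set.range D = (H : Set W.toAffine.Point) →
        ∀ k : ℕ, Odd k → k ≤ Nat.card W.toAffine.Point / 2 →
          IsLinearCode
              (agCode (fun i => W.toAffine.pointPlace (D i))
                (Finsupp.single (W.toAffine.pointPlace Q) (k : ℤ)))
              (Nat.card W.toAffine.Point / 2) k (Nat.card W.toAffine.Point / 2 - k + 1) ∧
            IsMDS
              (agCode (fun i => W.toAffine.pointPlace (D i))
                (Finsupp.single (W.toAffine.pointPlace Q) (k : ℤ)))) ∧
      (∀ P ∈ H, ∀ Q : W.toAffine.Point, Q ∉ H →
        ∀ (n : ℕ) (D : Fin n → W.toAffine.Point), Function.Injective D →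
          Set.range D = (H : Set W.toAffine.Point) \ {P} →
        ∀ k : ℕ, Even k → 0 < k → k ≤ Nat.card W.toAffine.Point / 2 - 1 →
          IsLinearCode
              (agCode (fun i => W.toAffine.pointPlace (D i))
                (Finsupp.single (W.toAffine.pointPlace P) ((k : ℤ) - 1) +
                  Finsupp.single (W.toAffine.pointPlace Q) 1))
              (Nat.card W.toAffine.Point / 2 - 1) k (Nat.card W.toAffine.Point / 2 - k) ∧
            IsMDS
              (agCode (fun i => W.toAffine.pointPlace (D i))
                (Finsupp.single (W.toAffine.pointPlace P) ((k : ℤ) - 1) +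
                  Finsupp.single (W.toAffine.pointPlace Q) 1))) := by
  refine ⟨exists_addSubgroup_index_eq_two hN, fun H hH => ⟨?_, ?_, ?_⟩⟩
  · by_contra! hQ
    rw [(AddSubgroup.eq_top_iff' H).2 hQ, AddSubgroup.index_top] at hH
    norm_num at hH
  · intro Q hQ n D hD hrange k hk hkN
    have hcard : Nat.card H * 2 = Nat.card W.toAffine.Point := hH ▸ H.card_mul_index
    have hn : n = Nat.card W.toAffine.Point / 2 := by
      have : Nat.card H = n := by
        rw [← SetLike.coe_sort_coe, ← hrange, Nat.card_range_of_injective hD, Nat.card_fin]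
      omega
    have hDH (i : Fin n) : D i ∈ H := hrange.le (Set.mem_range_self i)
    have hs : (Multiset.replicate k Q).card = k := Multiset.card_replicate k Q
    have hkQ : k • Q ∉ H := by
      obtain ⟨j, rfl⟩ := hk
      rw [add_nsmul, mul_nsmul, one_nsmul, AddSubgroup.add_mem_cancel_left]
      · exact hQ
      · exact AddSubgroup.nsmul_mem _ (AddSubgroup.two_smul_mem_of_index_two hH Q) j
    have hcode := WeierstrassCurve.Affine.isLinearCode_agCode (s := Multiset.replicate k Q)
      (by rw [hs]; exact hk.pos) (by omega) hD
      (fun i hi => hQ (Multiset.eq_of_mem_replicate hi ▸ hDH i))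
      (fun T hT => hkQ (by
        rw [← Multiset.sum_replicate, ← hT]
        exact sum_mem fun i _ => hDH i))
    rw [WeierstrassCurve.Affine.pointDivisor_replicate, hs] at hcode
    rw [← hn]
    exact ⟨hcode, hcode.isMDS (by omega)⟩
  · intro P hP Q hQ n D hD hrange k hk hk0 hkN
    have hcard : Nat.card H * 2 = Nat.card W.toAffine.Point := hH ▸ H.card_mul_index
    have hn : n = Nat.card W.toAffine.Point / 2 - 1 := by
      have : n = Nat.card H - 1 := by
        have h1 := Set.ncard_sdiff_singleton_of_mem (s := (H : Set W.toAffine.Point)) hP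
        rw [← hrange, ← Nat.card_coe_set_eq, ← Nat.card_coe_set_eq,
          Nat.card_range_of_injective hD, Nat.card_fin] at h1
        exact h1
      omega
    have hDH (i : Fin n) : D i ∈ (H : Set W.toAffine.Point) \ {P} :=
      hrange.le (Set.mem_range_self i)
    have hs : (Q ::ₘ Multiset.replicate (k - 1) P).card = k := by
      rw [Multiset.card_cons, Multiset.card_replicate]
      omega
    have hdiv : WeierstrassCurve.Affine.pointDivisor (Q ::ₘ Multiset.replicate (k - 1) P) =
        Finsupp.single (W.toAffine.pointPlace P) ((k : ℤ) - 1) +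
          Finsupp.single (W.toAffine.pointPlace Q) 1 := by
      rw [WeierstrassCurve.Affine.pointDivisor_cons,
        WeierstrassCurve.Affine.pointDivisor_replicate, Nat.cast_sub hk0, Nat.cast_one, add_comm]
    have hcode := WeierstrassCurve.Affine.isLinearCode_agCode
      (s := Q ::ₘ Multiset.replicate (k - 1) P) (by omega) (by omega) hD
      (fun i hi => by
        rcases Multiset.mem_cons.1 hi with h | h
        · exact hQ (h ▸ (hDH i).1)
        · exact (hDH i).2 (Multiset.eq_of_mem_replicate h))
      (fun T hT => hQ (by
        have hmem : Q + (k - 1) • P ∈ H := by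
          rw [← Multiset.sum_replicate, ← Multiset.sum_cons, ← hT]
          exact sum_mem fun i _ => (hDH i).1
        exact (H.add_mem_cancel_right (H.nsmul_mem hP _)).1 hmem))
    rw [hdiv, hs] at hcode
    rw [← hn, show Nat.card W.toAffine.Point / 2 - k = n - k + 1 by omega]
    exact ⟨hcode, hcode.isMDS (by omega)⟩
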